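/- All graphs are finite and simple. A cactus is a connected graph in which any two distinct cycles have at most one vertex in common. Let $G$ be a cactus with $n$ vertices, $k$ cycles and $b$ bridges, and suppose $k>0$. Let $d$ be the diameter of $G$ and let $R=\sum_{uv\in E(G)} 1/\sqrt{d_ud_v}$ be its Randić index, where $d_v$ denotes the degree of the vertex $v$. An articulation point is a vertex whose removal increases the number of connected components, a block is a maximal connected subgraph without articulation points of its own, and the BC-tree of $G$ is the graph whose vertices are the articulation points and the blocks of $G$, with an articulation point adjacent to each block that contains it. Call $G$ longitudinally symmetric if it has an involutive automorphism $\sigma$ (reflection across a longitudinal axis) which fixes two vertices at distance $d$ from one another (the ends of the axis), maps each block onto itself, and fixes no cycle pointwise. (a) If $b=0$, then $$R-d\ \ge\ -(k-1)\left(2-\sqrt2\right),\qquad R-\frac d2\ \ge\ \frac n4-(k-1)\left(\frac74-\sqrt2\right),$$ and both are equalities if the BC-tree of $G$ is a path and $G$ is longitudinally symmetric. (b) If $b>0$, then $$R-d\ \ge\ -\frac b2-(k-1)\left(2-\sqrt2\right)-3+\frac2{\sqrt3}+2\sqrt{\frac23},$$ $$R-\frac d2\ \ge\ \frac{n-b}4-(k-1)\left(\frac74-\sqrt2\right)-3+\frac2{\sqrt3}+2\sqrt{\frac23},$$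 and both are equalities if the BC-tree of $G$ is a path, $G$ is longitudinally symmetric, and $G$ has exactly two leaves (vertices of degree $1$) and exactly two bridges ($b=2$, so that both bridges are the pendant edges at these leaves). -/

import Mathlib

namespace SimpleGraph

variable {V : Type*}

/-- The Randić index: the sum over all edges `uv` of `1 / √(d_u d_v)`. -/
noncomputable def randicIndex (G : SimpleGraph V) [Fintype V] [DecidableEq V]
    [DecidableRel G.Adj] : ℝ :=
  ∑ e ∈ G.edgeFinset,
    Sym2.lift ⟨fun u v => 1 / Real.sqrt ((G.degree u : ℝ) * (G.degree v : ℝ)),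
      fun u v => by beta_reduce; rw [mul_comm]⟩ e

/-- The cycles of `G`, as subgraphs (so a cycle has neither base point nor orientation). -/
def cycles (G : SimpleGraph V) : Set G.Subgraph :=
  {C | ∃ (v : V) (p : G.Walk v v), p.IsCycle ∧ p.toSubgraph = C}

/-- The bridges of `G`: the edges whose removal disconnects their endpoints. -/
def bridges (G : SimpleGraph V) : Set (Sym2 V) :=
  {e | e ∈ G.edgeSet ∧ G.IsBridge e}

/-- A cactus: a connected graph in which any two distinct cycles share at most one vertex. -/
def IsCactus (G : SimpleGraph V) : Prop :=
  G.Connected ∧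
    ∀ C ∈ G.cycles, ∀ D ∈ G.cycles, C ≠ D → (C.verts ∩ D.verts).Subsingleton

/-- An articulation point (cut vertex): its removal splits the connected component it lies in,
that is, some two other vertices joined by a walk in `G` are not joined after its removal. -/
def IsArticulationPoint (G : SimpleGraph V) (v : V) : Prop :=
  ∃ (u w : V) (hu : u ≠ v) (hw : w ≠ v), G.Reachable u w ∧
    ¬ (G.induce {x | x ≠ v}).Reachable ⟨u, hu⟩ ⟨w, hw⟩

/-- A block: a maximal connected subgraph that has no articulation point of its own. -/
def IsBlock (G : SimpleGraph V) (B : G.Subgraph) : Prop :=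
  Maximal (fun H : G.Subgraph => H.Connected ∧ ∀ v : H.verts, ¬ H.coe.IsArticulationPoint v) B

/-- The block-cut tree: its vertices are the articulation points and the blocks of `G`, and an
articulation point is joined to every block that contains it. -/
def bcTree (G : SimpleGraph V) :
    SimpleGraph ({v : V // G.IsArticulationPoint v} ⊕ {B : G.Subgraph // G.IsBlock B}) :=
  SimpleGraph.fromRel fun x y =>
    ∃ v B, x = Sum.inl v ∧ y = Sum.inr B ∧ v.1 ∈ B.1.verts

/-- The graph is a path (on some number of vertices). -/
def IsPathGraph {W : Type*} (T : SimpleGraph W) : Prop :=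
  ∃ m : ℕ, Nonempty (T ≃g pathGraph m)

/-- A graph is longitudinally symmetric if it admits a reflection across a longitudinal axis:
an involutive automorphism `σ` that fixes both ends of the axis (two vertices at distance equal
to the diameter), maps each block to itself, and acts nontrivially on each cycle. -/
def IsLongitudinallySymmetric (G : SimpleGraph V) : Prop :=
  ∃ σ : G ≃g G,
    Function.Involutive σ ∧
    (∃ u v : V, G.dist u v = G.diam ∧ σ u = u ∧ σ v = v) ∧
    (∀ B : G.Subgraph, G.IsBlock B → σ '' B.verts = B.verts) ∧
    (∀ C ∈ G.cycles, ∃ x ∈ C.verts, σ x ≠ x)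

end SimpleGraph

/-!
A lower bound for the Randić index `R` of a cactus in terms of its diameter `d`.

Write `m` for the number of edges. In a cactus every edge that is not a bridge lies on exactly one
cycle, so `m = b + ∑ n_C`, where `n_C` is the length of the cycle `C`, and comparison with a
spanning tree gives `m = n + k - 1` (`IsCactus.card_edgeFinset_add_one`).

*From edges to vertices.* An edge with ends of degrees `p, q ≥ 2` satisfies
`1/√(pq) ≥ 1/√(2p) + 1/√(2q) - 1/2`, with equality iff `p = 2` or `q = 2`. Summing over the edges,
`R ≥ ∑ w(v) - m/2`, where `w(v) = √(d_v/2)` unless `v` is a leaf. A leaf gets a value of at least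
`1/2`, chosen so that pendant edges lose nothing (`sum_vertexWeight_le_randicIndex`).

*The inequalities.* Fix a shortest path `P` between two vertices at distance `d`. Off `P` we have
`w(v) ≥ 1`, except for leaves, which cost `1/2` each and are paid for by their pendant bridges.
A cycle has at most half of its edges on `P`, so that `d` is at most the number of bridges on `P`
plus half the total length of the cycles; a cycle which `P` avoids has length at least `3`. What
remains is a lower bound for `∑ (w(v) - 1)` over the vertices of `P`. Where `P` passes from one
cycle to another the degree is at least `4` and `w(v) - 1 ≥ √2 - 1`; where it passes between
a bridge and a cycle the degree is at least `3`, and two such passages are worth more than `√2 - 1`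
(`mul_card_labels_le`). A leaf at an end of `P`, together with the vertices up to the first cycle,
costs at most half of `3 - 2/√3 - 2√(2/3)` (`IsGeodesic.sum_prefix_ge`). This bounds `R - d/2`, and
`2d ≤ m + b` then gives the bound for `R - d`.

*Equality.* The ends of a diametral path are not articulation points. Let `σ` be the reflection
and `P` a shortest path between the fixed ends. As `σ` fixes no edge of a cycle pointwise
(`IsReflectionAxis.apply_ne`), `P` and `σP` have only bridges in common, and an edge of `P` on
a cycle can be bypassed along `σP`, so its whole cycle is contained in `P ∪ σP`. Since the block-cut
tree is a path, an articulation point lies in at most two blocks; it follows that `P ∪ σP` is all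
of `G` (`IsReflectionAxis.pathUnion_eq`). Hence `m + b = 2d`, all degrees are known, and no edge of
a cycle joins two vertices of degree greater than `2`, so that each estimate above is an equality.
-/

namespace SimpleGraph

variable {V : Type*} {G : SimpleGraph V} {C D : G.Subgraph}

/-! ### Cycles as subgraphs -/

theorem connected_of_mem_cycles (hC : C ∈ G.cycles) : C.Connected := by
  obtain ⟨v, p, -, rfl⟩ := hC
  exact p.toSubgraph_connected

theorem ncard_neighborSet_of_mem_cycles (hC : C ∈ G.cycles) {v : V} (hv : v ∈ C.verts) :
    (C.neighborSet v).ncard = 2 := by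
  obtain ⟨u, p, hp, rfl⟩ := hC
  exact hp.ncard_neighborSet_toSubgraph_eq_two (p.mem_verts_toSubgraph.1 hv)

/-- Every edge of a cycle has exactly one neighbouring edge at each of its ends. -/
theorem exists_other_neighbor (hC : C ∈ G.cycles) {x y : V} (h : C.Adj x y) :
    ∃ z, z ≠ y ∧ ∀ w, C.Adj x w ↔ w = y ∨ w = z := by
  obtain ⟨a, b, hab, h2⟩ := Set.ncard_eq_two.1 (ncard_neighborSet_of_mem_cycles hC h.fst_mem)
  have key : ∀ w, C.Adj x w ↔ w = a ∨ w = b := fun w => by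
    rw [← Subgraph.mem_neighborSet, h2]; simp
  rcases (key y).1 h with rfl | rfl
  · exact ⟨b, hab.symm, key⟩
  · exact ⟨a, hab, fun w => by rw [key, or_comm]⟩

theorem exists_adj_of_mem_cycles (hC : C ∈ G.cycles) {v : V} (hv : v ∈ C.verts) :
    ∃ w, C.Adj v w := by
  obtain ⟨a, b, -, h2⟩ := Set.ncard_eq_two.1 (ncard_neighborSet_of_mem_cycles hC hv)
  exact ⟨a, by rw [← Subgraph.mem_neighborSet, h2]; simp⟩

theorem Walk.IsCycle.ncard_edgeSet_toSubgraph {v : V} {p : G.Walk v v} (hp : p.IsCycle) :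
    p.toSubgraph.edgeSet.ncard = p.length := by
  classical
  have : p.toSubgraph.edgeSet = (p.edges.toFinset : Set (Sym2 V)) := by
    ext e
    rw [Walk.mem_edges_toSubgraph]
    simp
  rw [this, Set.ncard_coe_finset, List.toFinset_card_of_nodup hp.isTrail.edges_nodup,
    Walk.length_edges]

theorem three_le_ncard_edgeSet (hC : C ∈ G.cycles) : 3 ≤ C.edgeSet.ncard := by
  obtain ⟨v, p, hp, rfl⟩ := hC
  rw [hp.ncard_edgeSet_toSubgraph]
  exact hp.three_le_length

/-- Two vertices of a cycle are joined by the two arcs between them. -/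
theorem two_mul_dist_le_ncard_edgeSet (hC : C ∈ G.cycles) {x y : V} (hx : x ∈ C.verts)
    (hy : y ∈ C.verts) : 2 * G.dist x y ≤ C.edgeSet.ncard := by
  classical
  obtain ⟨v, p, hp, rfl⟩ := hC
  rw [hp.ncard_edgeSet_toSubgraph]
  rw [Walk.mem_verts_toSubgraph] at hx hy
  have hy' : y ∈ (p.rotate x hx).support := by simpa using hy
  have h1 := dist_le ((p.rotate x hx).takeUntil y hy')
  have h2 := dist_le ((p.rotate x hx).dropUntil y hy')
  have h3 := congrArg Walk.length ((p.rotate x hx).take_spec hy')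
  rw [Walk.length_append] at h3
  have h4 : (p.rotate x hx).length = p.length := by simp
  rw [dist_comm] at h2
  omega

theorem not_isBridge_of_mem_cycles (hC : C ∈ G.cycles) {e : Sym2 V} (he : e ∈ C.edgeSet) :
    ¬ G.IsBridge e := by
  obtain ⟨v, p, hp, rfl⟩ := hC
  exact fun h => h.notMem_edges_of_isCycle hp (p.mem_edges_toSubgraph.1 he)

/-- An edge of `H ≤ G` that can be bypassed inside `H` lies on a cycle of `G` all of whose edges
belong to `H`. -/
theorem exists_mem_cycles_edgeSet_subset {H : SimpleGraph V} (hH : H ≤ G) {x y : V}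
    (hxy : H.Adj x y) (h : (H.deleteEdges {s(x, y)}).Reachable x y) :
    ∃ C ∈ G.cycles, C.Adj x y ∧ C.edgeSet ⊆ H.edgeSet := by
  obtain ⟨u, p, hp, he⟩ := adj_and_reachable_delete_edges_iff_exists_cycle.1 ⟨hxy, h⟩
  refine ⟨_, ⟨u, p.mapLe hH, (Walk.isCycle_mapLe hH).2 hp, rfl⟩, ?_, ?_⟩
  · rw [Walk.adj_toSubgraph_mapLe, Walk.adj_toSubgraph_iff_mem_edges]
    exact he
  · intro e
    induction e with | h a b => ?_
    rw [Subgraph.mem_edgeSet, Walk.adj_toSubgraph_mapLe]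
    exact fun h => h.adj_sub

theorem exists_mem_cycles_of_not_isBridge {x y : V} (hxy : G.Adj x y)
    (h : ¬ G.IsBridge s(x, y)) : ∃ C ∈ G.cycles, C.Adj x y := by
  rw [isBridge_iff, not_not] at h
  obtain ⟨C, hC, h, -⟩ := exists_mem_cycles_edgeSet_subset le_rfl hxy h
  exact ⟨C, hC, h⟩

theorem exists_mem_edgeSet_notMem_of_isAcyclic (hC : C ∈ G.cycles) {T : SimpleGraph V}
    (hT : T.IsAcyclic) : ∃ e ∈ C.edgeSet, e ∉ T.edgeSet := by
  by_contra! h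
  obtain ⟨v, p, hp, rfl⟩ := hC
  have h' : ∀ e ∈ p.edges, e ∈ T.edgeSet := fun e he => h e (p.mem_edges_toSubgraph.2 he)
  exact hT (p.transfer T h') (hp.transfer h')

/-- In a cactus the cycle through an edge is unique. -/
theorem IsCactus.cycle_unique (hG : G.IsCactus) (hC : C ∈ G.cycles) (hD : D ∈ G.cycles)
    {x y : V} (h : C.Adj x y) (h' : D.Adj x y) : C = D := by
  by_contra hne
  exact h.ne (hG.2 C hC D hD hne ⟨h.fst_mem, h'.fst_mem⟩ ⟨h.snd_mem, h'.snd_mem⟩)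

theorem IsCactus.cycle_unique' (hG : G.IsCactus) (hC : C ∈ G.cycles) (hD : D ∈ G.cycles)
    {e : Sym2 V} (h : e ∈ C.edgeSet) (h' : e ∈ D.edgeSet) : C = D := by
  induction e with | h a b => exact hG.cycle_unique hC hD h h'

/-- The cycles of a cactus have no chords: a chord would lie on a second cycle that shares two
vertices with the given one. -/
theorem IsCactus.adj_of_mem_verts (hG : G.IsCactus) (hC : C ∈ G.cycles) {x y : V}
    (hx : x ∈ C.verts) (hy : y ∈ C.verts) (hxy : G.Adj x y) : C.Adj x y := by
  by_contra hn
  have hr : (G.deleteEdges {s(x, y)}).Reachable x y := by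
    have h1 := (connected_of_mem_cycles hC).preconnected.coe ⟨x, hx⟩ ⟨y, hy⟩
    refine h1.map (⟨Subtype.val, ?_⟩ : C.coe →g G.deleteEdges {s(x, y)})
    intro a b hab
    have hab' : C.Adj a b := hab
    rw [deleteEdges_adj]
    refine ⟨hab'.adj_sub, fun h => hn ?_⟩
    rw [Set.mem_singleton_iff] at h
    rwa [← Subgraph.mem_edgeSet, ← h]
  obtain ⟨D, hD, hDa, -⟩ := exists_mem_cycles_edgeSet_subset le_rfl hxy hr
  have hne : C ≠ D := by rintro rfl; exact hn hDa
  exact hxy.ne (hG.2 C hC D hD hne ⟨hx, hDa.fst_mem⟩ ⟨hy, hDa.snd_mem⟩)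

theorem finite_cycles [Finite V] : G.cycles.Finite := Set.toFinite _

/-- The cycles of a cactus correspond to the edges outside a spanning tree: each such edge closes
one cycle, and a cycle with two of them would be the fundamental cycle of both. -/
theorem IsCactus.card_edgeFinset_add_one [Fintype V] [Fintype G.edgeSet] (hG : G.IsCactus) :
    G.edgeFinset.card + 1 = Fintype.card V + G.cycles.ncard := by
  classical
  obtain ⟨T, hTG, hT⟩ := hG.1.exists_isTree_le
  have hTc := hT.card_edgeFinset
  have hfund : ∀ e ∈ G.edgeSet \ T.edgeSet, ∃ C ∈ G.cycles, e ∈ C.edgeSet ∧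
      ∀ f ∈ C.edgeSet, f ∈ T.edgeSet ∨ f = e := by
    intro e
    induction e with | h x y => ?_
    rintro ⟨hxy, hxyT⟩
    have hxy' : G.Adj x y := hxy
    have hle : T ⊔ edge x y ≤ G := sup_le hTG (by
      rw [edge_le_iff]; exact Or.inr hxy')
    obtain ⟨C, hC, hCa, hCs⟩ := exists_mem_cycles_edgeSet_subset hle (x := x) (y := y)
      (Or.inr (by rw [edge_adj]; exact ⟨Or.inl ⟨rfl, rfl⟩, hxy'.ne⟩))
      ((hT.connected.preconnected x y).mono (by
        intro a b hab
        rw [deleteEdges_adj]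
        refine ⟨Or.inl hab, fun h => hxyT ?_⟩
        rw [Set.mem_singleton_iff] at h
        rw [← h]; exact hab))
    refine ⟨C, hC, hCa, fun f hf => ?_⟩
    have := hCs hf
    rw [edgeSet_sup] at this
    rcases this with h | h
    · exact Or.inl h
    · rw [edgeSet_edge] at h
      exact Or.inr h.1
  choose! F hF1 hF2 hF3 using hfund
  have hbij : Set.BijOn F (G.edgeSet \ T.edgeSet) G.cycles := by
    refine ⟨fun e he => hF1 e he, fun e he e' he' h => ?_, fun C hC => ?_⟩
    · rcases hF3 e' he' e (h ▸ hF2 e he) with h1 | h1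
      · exact absurd h1 he.2
      · exact h1
    · obtain ⟨e, he, heT⟩ := exists_mem_edgeSet_notMem_of_isAcyclic hC hT.isAcyclic
      have he' : e ∈ G.edgeSet \ T.edgeSet := ⟨C.edgeSet_subset he, heT⟩
      exact ⟨e, he', hG.cycle_unique' (hF1 e he') hC (hF2 e he') he⟩
  have h1 : (G.edgeSet \ T.edgeSet).ncard = G.cycles.ncard := by
    rw [← hbij.image_eq, hbij.injOn.ncard_image]
  have h2 := Set.ncard_sdiff_add_ncard_of_subset (edgeSet_mono hTG)
  rw [h1, ← coe_edgeFinset, ← coe_edgeFinset, Set.ncard_coe_finset, Set.ncard_coe_finset] at h2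
  omega

end SimpleGraph

namespace SimpleGraph

variable {V : Type*} [Fintype V] {G : SimpleGraph V} [DecidableRel G.Adj]

/-! ### The Randić index as a sum of vertex weights -/

theorem sum_edgeFinset_lift_add [DecidableEq V] (a : V → V → ℝ)
    (f : {f : V → V → ℝ // ∀ x y, f x y = f y x}) (hf : ∀ x y, f.1 x y = a x y + a y x) :
    ∑ e ∈ G.edgeFinset, Sym2.lift f e = ∑ x, ∑ y ∈ G.neighborFinset x, a x y := by
  have h1 : ∑ x, ∑ y ∈ G.neighborFinset x, a x y = ∑ d : G.Dart, a d.fst d.snd := by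
    rw [← Finset.sum_fiberwise (s := Finset.univ) (g := fun d : G.Dart => d.fst)]
    refine Finset.sum_congr rfl fun x _ => ?_
    refine Finset.sum_bij' (i := fun y hy => (⟨(x, y), by simpa using hy⟩ : G.Dart))
      (j := fun d _ => d.snd) ?_ ?_ ?_ ?_ ?_
    · intro y hy; simp
    · intro d hd
      have : d.fst = x := by simpa using hd
      rw [mem_neighborFinset, ← this]; exact d.adj
    · intro y hy; rfl
    · intro d hd
      have : d.fst = x := by simpa using hd
      ext <;> simp [this]
    · intro y hy; rfl
  rw [h1, ← Finset.sum_fiberwise_of_maps_to (s := Finset.univ) (t := G.edgeFinset)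
    (g := fun d : G.Dart => d.edge) (fun d _ => by simp)]
  refine Finset.sum_congr rfl fun e he => ?_
  induction e with | h x y => ?_
  have hxy : G.Adj x y := by simpa using he
  let d : G.Dart := ⟨(x, y), hxy⟩
  have h2 : (Finset.univ.filter fun d' : G.Dart => d'.edge = s(x, y)) = {d, d.symm} := d.edge_fiber
  rw [h2, Finset.sum_pair d.symm_ne.symm, Sym2.lift_mk, hf]
  rfl

variable (G) in
/-- The share of the edge `xy` charged to its end `x`. Unless both ends are leaves, an edge weighs
at least the sum of its two shares minus `1 / 2`. At a vertex of degree at least `2` the share is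
`1 / √(2 d_x)`; the share of a leaf is what makes this an equality for pendant edges. -/
noncomputable def halfEdgeWeight (x y : V) : ℝ :=
  if G.degree x = 1 then 1 / 2 + (1 - √2 / 2) / √(G.degree y) else √2 / 2 / √(G.degree x)

variable (G) in
/-- The sum of the shares of all edges at `x`. -/
noncomputable def vertexWeight (x : V) : ℝ := ∑ y ∈ G.neighborFinset x, G.halfEdgeWeight x y

theorem vertexWeight_of_two_le {x : V} (h : 2 ≤ G.degree x) :
    G.vertexWeight x = √2 / 2 * √(G.degree x) := by
  have h1 : ∀ y, G.halfEdgeWeight x y = √2 / 2 / √(G.degree x) := fun y => by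
    rw [halfEdgeWeight, if_neg (by omega)]
  have h2 : (0 : ℝ) < G.degree x := by exact_mod_cast (by omega : 0 < G.degree x)
  have h3 := Real.mul_self_sqrt h2.le
  have h4 := Real.sqrt_pos.2 h2
  rw [vertexWeight, Finset.sum_congr rfl fun y _ => h1 y, Finset.sum_const,
    card_neighborFinset_eq_degree, nsmul_eq_mul]
  field_simp
  nlinarith

theorem vertexWeight_of_degree_eq_one {x y : V} (h : G.degree x = 1) (hxy : G.Adj x y) :
    G.vertexWeight x = 1 / 2 + (1 - √2 / 2) / √(G.degree y) := by
  have h1 : G.neighborFinset x = {y} := by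
    rw [← card_neighborFinset_eq_degree, Finset.card_eq_one] at h
    obtain ⟨z, hz⟩ := h
    have : y ∈ G.neighborFinset x := by simpa using hxy
    rw [hz, Finset.mem_singleton] at this
    rw [hz, this]
  rw [vertexWeight, h1, Finset.sum_singleton, halfEdgeWeight, if_pos h]

theorem sqrt_two_bounds : 1.414213 < √2 ∧ √2 < 1.414214 := by
  constructor
  · exact Real.lt_sqrt_of_sq_lt (by norm_num)
  · rw [Real.sqrt_lt' (by norm_num)]; norm_num

theorem sqrt_two_div_two_mul_self : √2 / 2 * (√2 / 2) = 1 / 2 := by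
  have := Real.mul_self_sqrt (show (0 : ℝ) ≤ 2 by norm_num)
  linarith

theorem inv_sqrt_le {q : ℕ} (h : 2 ≤ q) : 1 / √(q : ℝ) ≤ √2 / 2 := by
  have h1 : √2 ≤ √(q : ℝ) := Real.sqrt_le_sqrt (by exact_mod_cast h)
  have h0 : 0 < √2 := by positivity
  have h2 := sqrt_two_div_two_mul_self
  rw [div_le_iff₀ (by linarith)]
  nlinarith

theorem one_div_sqrt_mul (p q : ℕ) :
    1 / √((p : ℝ) * q) = 1 / √(p : ℝ) * (1 / √(q : ℝ)) := by
  rw [Real.sqrt_mul (Nat.cast_nonneg p), one_div_mul_one_div]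

/-- An edge whose ends are not both leaves weighs at least its two shares minus `1 / 2`: for ends
of degrees `p, q ≥ 2` this is `(1/√2 - 1/√p) (1/√2 - 1/√q) ≥ 0`. -/
theorem halfEdgeWeight_add_le {x y : V} (hxy : G.Adj x y)
    (h : ¬ (G.degree x = 1 ∧ G.degree y = 1)) :
    G.halfEdgeWeight x y + G.halfEdgeWeight y x - 1 / 2 ≤
      1 / √((G.degree x : ℝ) * G.degree y) := by
  have hx : 0 < G.degree x := (G.degree_pos_iff_exists_adj x).2 ⟨y, hxy⟩
  have hy : 0 < G.degree y := (G.degree_pos_iff_exists_adj y).2 ⟨x, hxy.symm⟩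
  rw [one_div_sqrt_mul]
  unfold halfEdgeWeight
  split_ifs with h1 h2 h2
  · exact absurd ⟨h1, h2⟩ h
  · rw [h1]
    simp only [Nat.cast_one, Real.sqrt_one, div_eq_mul_one_div (1 - √2 / 2),
      div_eq_mul_one_div (√2 / 2)]
    linarith
  · rw [h2]
    simp only [Nat.cast_one, Real.sqrt_one, div_eq_mul_one_div (1 - √2 / 2),
      div_eq_mul_one_div (√2 / 2)]
    linarith
  · have h3 := inv_sqrt_le (show 2 ≤ G.degree x by omega)
    have h4 := inv_sqrt_le (show 2 ≤ G.degree y by omega)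
    have h5 := sqrt_two_div_two_mul_self
    rw [div_eq_mul_one_div (√2 / 2) √(G.degree x : ℝ),
      div_eq_mul_one_div (√2 / 2) √(G.degree y : ℝ)]
    nlinarith [mul_nonneg (sub_nonneg.2 h3) (sub_nonneg.2 h4)]

/-- Equality case of `halfEdgeWeight_add_le`. -/
theorem halfEdgeWeight_add_eq {x y : V} (hxy : G.Adj x y)
    (h : ¬ (G.degree x = 1 ∧ G.degree y = 1))
    (h' : G.degree x ≤ 2 ∨ G.degree y ≤ 2) :
    G.halfEdgeWeight x y + G.halfEdgeWeight y x - 1 / 2 =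
      1 / √((G.degree x : ℝ) * G.degree y) := by
  have hx : 0 < G.degree x := (G.degree_pos_iff_exists_adj x).2 ⟨y, hxy⟩
  have hy : 0 < G.degree y := (G.degree_pos_iff_exists_adj y).2 ⟨x, hxy.symm⟩
  have h2' : 1 / √((2 : ℕ) : ℝ) = √2 / 2 := by
    rw [Nat.cast_ofNat, div_eq_div_iff (by positivity) (by norm_num)]
    have := Real.mul_self_sqrt (show (0 : ℝ) ≤ 2 by norm_num)
    linarith
  rw [one_div_sqrt_mul]
  unfold halfEdgeWeight
  split_ifs with h1 h2 h2
  · exact absurd ⟨h1, h2⟩ h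
  · rw [h1]
    simp only [Nat.cast_one, Real.sqrt_one, div_eq_mul_one_div (1 - √2 / 2),
      div_eq_mul_one_div (√2 / 2)]
    linarith
  · rw [h2]
    simp only [Nat.cast_one, Real.sqrt_one, div_eq_mul_one_div (1 - √2 / 2),
      div_eq_mul_one_div (√2 / 2)]
    linarith
  · have h5 := sqrt_two_div_two_mul_self
    rw [div_eq_mul_one_div (√2 / 2) √(G.degree x : ℝ),
      div_eq_mul_one_div (√2 / 2) √(G.degree y : ℝ)]
    rcases h' with h' | h'
    · rw [show G.degree x = 2 by omega, h2']
      linarith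
    · rw [show G.degree y = 2 by omega, h2']
      linarith

theorem sum_vertexWeight [DecidableEq V] :
    ∑ x, G.vertexWeight x - (G.edgeFinset.card : ℝ) / 2 =
      ∑ e ∈ G.edgeFinset, Sym2.lift ⟨fun x y => G.halfEdgeWeight x y + G.halfEdgeWeight y x
        - 1 / 2, fun x y => by ring⟩ e := by
  have := sum_edgeFinset_lift_add (G := G) (fun x y => G.halfEdgeWeight x y - 1 / 4)
    ⟨fun x y => G.halfEdgeWeight x y + G.halfEdgeWeight y x - 1 / 2, fun x y => by ring⟩
    (fun x y => by ring)
  rw [this]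
  simp only [Finset.sum_sub_distrib, Finset.sum_const, card_neighborFinset_eq_degree,
    nsmul_eq_mul, ← Finset.sum_mul]
  have h2 := G.sum_degrees_eq_twice_card_edges
  have h3 : (∑ x, (G.degree x : ℝ)) = 2 * G.edgeFinset.card := by exact_mod_cast h2
  rw [h3]
  simp only [vertexWeight]
  ring

theorem sum_vertexWeight_le_randicIndex [DecidableEq V]
    (h : ∀ x y, G.Adj x y → ¬ (G.degree x = 1 ∧ G.degree y = 1)) :
    ∑ x, G.vertexWeight x - (G.edgeFinset.card : ℝ) / 2 ≤ G.randicIndex := by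
  rw [sum_vertexWeight, randicIndex]
  refine Finset.sum_le_sum fun e he => ?_
  induction e with | h x y => ?_
  have hxy : G.Adj x y := by simpa using he
  exact halfEdgeWeight_add_le hxy (h x y hxy)

theorem randicIndex_eq_sum_vertexWeight [DecidableEq V]
    (h : ∀ x y, G.Adj x y → ¬ (G.degree x = 1 ∧ G.degree y = 1))
    (h' : ∀ x y, G.Adj x y → G.degree x ≤ 2 ∨ G.degree y ≤ 2) :
    G.randicIndex = ∑ x, G.vertexWeight x - (G.edgeFinset.card : ℝ) / 2 := by
  rw [sum_vertexWeight, randicIndex]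
  refine Finset.sum_congr rfl fun e he => ?_
  induction e with | h x y => ?_
  have hxy : G.Adj x y := by simpa using he
  exact (halfEdgeWeight_add_eq hxy (h x y hxy) (h' x y hxy)).symm

/-! ### Bounds for the vertex weights -/

theorem vertexWeight_ge {x : V} {q : ℕ} (hq : 2 ≤ q) (h : q ≤ G.degree x) :
    √2 / 2 * √(q : ℝ) ≤ G.vertexWeight x := by
  rw [vertexWeight_of_two_le (hq.trans h)]
  gcongr

theorem one_le_vertexWeight {x : V} (h : 2 ≤ G.degree x) : 1 ≤ G.vertexWeight x := by
  have h1 := vertexWeight_ge le_rfl h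
  have h2 := sqrt_two_div_two_mul_self
  norm_num at h1
  linarith

theorem sqrt_two_le_vertexWeight {x : V} (h : 4 ≤ G.degree x) : √2 ≤ G.vertexWeight x := by
  have h1 := vertexWeight_ge (by norm_num) h
  rw [show ((4 : ℕ) : ℝ) = 2 ^ 2 by norm_num, Real.sqrt_sq (by norm_num)] at h1
  linarith

theorem sqrt_three_bounds : 1.73205 < √3 ∧ √3 < 1.732051 := by
  constructor
  · exact Real.lt_sqrt_of_sq_lt (by norm_num)
  · rw [Real.sqrt_lt' (by norm_num)]; norm_num

theorem half_le_vertexWeight {x : V} (h : 1 ≤ G.degree x) : 1 / 2 ≤ G.vertexWeight x := by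
  rcases h.eq_or_lt with h1 | h1
  · obtain ⟨y, hy⟩ := (G.degree_pos_iff_exists_adj x).1 h
    rw [vertexWeight_of_degree_eq_one h1.symm hy]
    have h2 := sqrt_two_bounds.2
    have : 0 ≤ (1 - √2 / 2) / √(G.degree y) := by
      apply div_nonneg <;> [linarith; positivity]
    linarith
  · linarith [one_le_vertexWeight h1]

/-- The function `q ↦ √2/2 √q + (1 - √2/2) / √q` is increasing on `q ≥ 1`. -/
theorem leaf_pair_mono {p q : ℝ} (hp : 1 ≤ p) (hpq : p ≤ q) :
    √2 / 2 * √p + (1 - √2 / 2) / √p ≤ √2 / 2 * √q + (1 - √2 / 2) / √q := by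
  have h1 : √p ≤ √q := Real.sqrt_le_sqrt hpq
  have h2 : 1 ≤ √p := Real.one_le_sqrt.2 hp
  obtain ⟨h3, h4⟩ := sqrt_two_bounds
  set a := √p
  set b := √q
  have ha : 0 < a := by linarith
  have hb : 0 < b := by linarith
  have : √2 / 2 * b + (1 - √2 / 2) / b - (√2 / 2 * a + (1 - √2 / 2) / a) =
      (b - a) * (√2 / 2 * (a * b) - (1 - √2 / 2)) / (a * b) := by
    field_simp
    ring
  have h5 : 1 ≤ a * b := by nlinarith
  have : 0 ≤ (b - a) * (√2 / 2 * (a * b) - (1 - √2 / 2)) / (a * b) := by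
    apply div_nonneg (mul_nonneg (by linarith) (by nlinarith)) (by positivity)
  linarith

theorem leaf_add_vertexWeight_ge {x y : V} {q : ℕ} (hq : 2 ≤ q) (hx : G.degree x = 1)
    (hxy : G.Adj x y) (hy : q ≤ G.degree y) :
    1 / 2 + (√2 / 2 * √(q : ℝ) + (1 - √2 / 2) / √(q : ℝ)) ≤
      G.vertexWeight x + G.vertexWeight y := by
  rw [vertexWeight_of_degree_eq_one hx hxy, vertexWeight_of_two_le (hq.trans hy)]
  have := leaf_pair_mono (p := q) (q := G.degree y) (by exact_mod_cast (by omega : 1 ≤ q))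
    (by exact_mod_cast hy)
  linarith

end SimpleGraph

namespace SimpleGraph

variable {V : Type*} {G : SimpleGraph V}

/-! ### Geodesics -/

/-- The vertices `x 0, …, x d` form a shortest path. -/
structure IsGeodesic (G : SimpleGraph V) (x : ℕ → V) (d : ℕ) : Prop where
  adj : ∀ i < d, G.Adj (x i) (x (i + 1))
  dist_eq : ∀ i j, i ≤ j → j ≤ d → G.dist (x i) (x j) = j - i

theorem Connected.dist_le_of_adj (hG : G.Connected) {x : ℕ → V} {d : ℕ}
    (h : ∀ i < d, G.Adj (x i) (x (i + 1))) {i j : ℕ} (hij : i ≤ j) (hj : j ≤ d) :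
    G.dist (x i) (x j) ≤ j - i := by
  induction j, hij using Nat.le_induction with
  | base => simp
  | succ j hij ih =>
    have h1 := hG.dist_triangle (u := x i) (v := x j) (w := x (j + 1))
    have h2 := dist_eq_one_iff_adj.2 (h j (by omega))
    have := ih (by omega)
    omega

theorem Connected.isGeodesic (hG : G.Connected) {x : ℕ → V} {d : ℕ}
    (h : ∀ i < d, G.Adj (x i) (x (i + 1))) (hd : G.dist (x 0) (x d) = d) :
    G.IsGeodesic x d := by
  refine ⟨h, fun i j hij hj => ?_⟩
  have h1 := hG.dist_le_of_adj h hij hj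
  have h2 := hG.dist_le_of_adj h (Nat.zero_le i) (hij.trans hj)
  have h3 := hG.dist_le_of_adj h hj le_rfl
  have h4 := hG.dist_triangle (u := x 0) (v := x i) (w := x d)
  have h5 := hG.dist_triangle (u := x i) (v := x j) (w := x d)
  omega

theorem Connected.exists_isGeodesic (hG : G.Connected) (u v : V) :
    ∃ x : ℕ → V, x 0 = u ∧ x (G.dist u v) = v ∧ G.IsGeodesic x (G.dist u v) := by
  obtain ⟨p, hp⟩ := hG.exists_walk_length_eq_dist u v
  have h0 : p.getVert 0 = u := p.getVert_zero
  have hd : p.getVert (G.dist u v) = v := by rw [← hp, p.getVert_length]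
  refine ⟨p.getVert, h0, hd, hG.isGeodesic (fun i hi => ?_) (by rw [h0, hd])⟩
  exact p.adj_getVert_succ (by omega)

namespace IsGeodesic

variable {x : ℕ → V} {d : ℕ}

theorem injOn (hx : G.IsGeodesic x d) {i j : ℕ} (hi : i ≤ d) (hj : j ≤ d) (h : x i = x j) :
    i = j := by
  rcases le_total i j with hij | hij
  · have := hx.dist_eq i j hij hj
    rw [h, dist_self] at this; omega
  · have := hx.dist_eq j i hij hi
    rw [h, dist_self] at this; omega

theorem edge_injOn (hx : G.IsGeodesic x d) {i j : ℕ} (hi : i < d) (hj : j < d)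
    (h : s(x i, x (i + 1)) = s(x j, x (j + 1))) : i = j := by
  rcases Sym2.eq_iff.1 h with ⟨h1, -⟩ | ⟨h1, h2⟩
  · exact hx.injOn hi.le hj.le h1
  · have := hx.injOn hi.le (by omega) h1
    have := hx.injOn (by omega) hj.le h2
    omega

theorem reverse (hx : G.IsGeodesic x d) : G.IsGeodesic (fun i => x (d - i)) d := by
  refine ⟨fun i hi => ?_, fun i j hij hj => ?_⟩
  · have := hx.adj (d - (i + 1)) (by omega)
    rw [show d - (i + 1) + 1 = d - i by omega] at this
    exact this.symm
  · rw [dist_comm]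
    have := hx.dist_eq (d - j) (d - i) (by omega) (by omega)
    show G.dist (x (d - j)) (x (d - i)) = _
    omega

open Classical in
/-- A geodesic uses at most half of the edges of a cycle. -/
theorem two_mul_card_le (hx : G.IsGeodesic x d) {C : G.Subgraph} (hC : C ∈ G.cycles) :
    2 * ((Finset.range d).filter fun i => C.Adj (x i) (x (i + 1))).card ≤ C.edgeSet.ncard := by
  set I := (Finset.range d).filter fun i => C.Adj (x i) (x (i + 1)) with hI
  rcases I.eq_empty_or_nonempty with h | h
  · simp [h]
  have h1 := Finset.min'_mem I h
  have h2 := Finset.max'_mem I h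
  set i := I.min' h
  set j := I.max' h
  have hij : i ≤ j := I.min'_le j h2
  have hsub : I ⊆ Finset.Icc i j := fun t ht => Finset.mem_Icc.2 ⟨I.min'_le t ht, I.le_max' t ht⟩
  have hcard := Finset.card_le_card hsub
  rw [Nat.card_Icc] at hcard
  rw [hI, Finset.mem_filter, Finset.mem_range] at h1 h2
  have := two_mul_dist_le_ncard_edgeSet hC h1.2.fst_mem h2.2.snd_mem
  rw [hx.dist_eq i (j + 1) (by omega) (by omega)] at this
  omega

end IsGeodesic

/-! ### Degrees at a cycle -/

section Degree

variable [Fintype V] [DecidableRel G.Adj] {C D : G.Subgraph}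

theorem two_le_degree_of_adj_of_adj {x y z : V} (hy : G.Adj x y) (hz : G.Adj x z) (h : y ≠ z) :
    2 ≤ G.degree x := by
  classical
  rw [← card_neighborFinset_eq_degree, ← Finset.card_pair h]
  refine Finset.card_le_card fun w => ?_
  simp only [Finset.mem_insert, Finset.mem_singleton, mem_neighborFinset]
  rintro (rfl | rfl) <;> assumption

theorem two_le_degree_of_mem_cycles (hC : C ∈ G.cycles) {x y : V} (h : C.Adj x y) :
    2 ≤ G.degree x := by
  obtain ⟨z, hz, h2⟩ := exists_other_neighbor hC h
  exact two_le_degree_of_adj_of_adj h.adj_sub ((h2 z).2 (Or.inr rfl)).adj_sub hz.symm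

theorem three_le_degree_of_mem_cycles (hC : C ∈ G.cycles) {x y w : V} (h : C.Adj x y)
    (hw : G.Adj x w) (hw' : ¬ C.Adj x w) : 3 ≤ G.degree x := by
  classical
  obtain ⟨z, hz, h2⟩ := exists_other_neighbor hC h
  have hz' := (h2 z).2 (Or.inr rfl)
  have h1 : w ≠ y := by rintro rfl; exact hw' h
  have h3 : w ≠ z := by rintro rfl; exact hw' hz'
  have h4 : ({w, y, z} : Finset V).card = 3 := by
    rw [Finset.card_insert_of_notMem (by simp [h1, h3]), Finset.card_pair hz.symm]
  rw [← card_neighborFinset_eq_degree, ← h4]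
  refine Finset.card_le_card fun a => ?_
  simp only [Finset.mem_insert, Finset.mem_singleton, mem_neighborFinset]
  rintro (rfl | rfl | rfl)
  exacts [hw, h.adj_sub, hz'.adj_sub]

theorem IsCactus.four_le_degree_of_mem_cycles (hG : G.IsCactus) (hC : C ∈ G.cycles)
    (hD : D ∈ G.cycles) (hne : C ≠ D) {x y w : V} (h : C.Adj x y) (h' : D.Adj x w) :
    4 ≤ G.degree x := by
  classical
  obtain ⟨z, hz, h2⟩ := exists_other_neighbor hC h
  obtain ⟨t, ht, h2'⟩ := exists_other_neighbor hD h'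
  have hz' := (h2 z).2 (Or.inr rfl)
  have ht' := (h2' t).2 (Or.inr rfl)
  have key : ∀ a b, C.Adj x a → D.Adj x b → a ≠ b := by
    rintro a b ha hb rfl
    exact hne (hG.cycle_unique hC hD ha hb)
  have h4 : ({w, t, y, z} : Finset V).card = 4 := by
    rw [Finset.card_insert_of_notMem, Finset.card_insert_of_notMem, Finset.card_pair hz.symm]
    · simp [(key _ _ h ht').symm, (key _ _ hz' ht').symm]
    · simp [(key _ _ h h').symm, (key _ _ hz' h').symm, ht.symm]
  rw [← card_neighborFinset_eq_degree, ← h4]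
  refine Finset.card_le_card fun a => ?_
  simp only [Finset.mem_insert, Finset.mem_singleton, mem_neighborFinset]
  rintro (rfl | rfl | rfl | rfl)
  exacts [h'.adj_sub, ht'.adj_sub, h.adj_sub, hz'.adj_sub]

/-- A connected graph with a cycle has no two adjacent leaves. -/
theorem Connected.not_adjacent_leaves (hG : G.Connected) (hC : C ∈ G.cycles) {x y : V}
    (hxy : G.Adj x y) : ¬ (G.degree x = 1 ∧ G.degree y = 1) := by
  rintro ⟨hx, hy⟩
  have key : ∀ {a b : V}, G.degree a = 1 → G.Adj a b → ∀ c, G.Adj a c → c = b := by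
    intro a b ha hab c hac
    by_contra hne
    have := two_le_degree_of_adj_of_adj hac hab hne
    omega
  have hwalk : ∀ a b : V, G.Walk a b → a = x ∨ a = y → b = x ∨ b = y := by
    intro a b p
    induction p with
    | nil => exact id
    | cons h p ih =>
      rintro (rfl | rfl)
      · exact ih (Or.inr (key hx hxy _ h))
      · exact ih (Or.inl (key hy hxy.symm _ h))
  obtain ⟨z, hz⟩ := (connected_of_mem_cycles hC).nonempty
  obtain ⟨w, hw⟩ := exists_adj_of_mem_cycles hC hz
  have h2 := two_le_degree_of_mem_cycles hC hw
  obtain ⟨p⟩ := hG.preconnected x z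
  rcases hwalk x z p (Or.inl rfl) with rfl | rfl <;> omega

theorem Connected.one_le_degree (hG : G.Connected) (hC : C ∈ G.cycles) (v : V) :
    1 ≤ G.degree v := by
  obtain ⟨z, hz⟩ := (connected_of_mem_cycles hC).nonempty
  obtain ⟨w, hw⟩ := exists_adj_of_mem_cycles hC hz
  have : Nontrivial V := ⟨z, w, hw.ne⟩
  exact hG.preconnected.degree_pos_of_nontrivial v

end Degree

/-! ### Counting edges by cycles and bridges -/

open Classical in
theorem IsCactus.card_edgeFinset_eq [Fintype V] [Fintype G.edgeSet] (hG : G.IsCactus) :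
    G.edgeFinset.card = G.bridges.ncard + ∑ C ∈ (finite_cycles (G := G)).toFinset,
      C.edgeSet.ncard := by
  have h1 : G.edgeFinset = G.bridges.toFinset ∪
      (finite_cycles (G := G)).toFinset.biUnion fun C => C.edgeSet.toFinset := by
    ext e
    induction e with | h x y => ?_
    simp only [mem_edgeFinset, Finset.mem_union, Set.mem_toFinset, Finset.mem_biUnion,
      Set.Finite.mem_toFinset]
    constructor
    · intro h
      by_cases hb : G.IsBridge s(x, y)
      · exact Or.inl ⟨h, hb⟩
      · exact Or.inr (exists_mem_cycles_of_not_isBridge h hb)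
    · rintro (h | ⟨C, -, h⟩)
      · exact h.1
      · exact C.edgeSet_subset h
  rw [h1, Finset.card_union_of_disjoint, Finset.card_biUnion, ← Set.ncard_eq_toFinset_card']
  · simp only [Set.ncard_eq_toFinset_card']
  · intro C hC D hD hne
    rw [Set.Finite.coe_toFinset] at hC hD
    refine Finset.disjoint_left.2 ?_
    intro e he he'
    rw [Set.mem_toFinset] at he he'
    exact hne (hG.cycle_unique' hC hD he he')
  · rw [Finset.disjoint_left]
    intro e he he'
    rw [Set.mem_toFinset] at he
    simp only [Finset.mem_biUnion, Set.mem_toFinset, Set.Finite.mem_toFinset] at he'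
    obtain ⟨C, hC, h⟩ := he'
    exact not_isBridge_of_mem_cycles hC h he.2

open Classical in
/-- The edges of a geodesic, sorted by bridges and cycles. -/
theorem IsCactus.length_eq [Fintype V] (hG : G.IsCactus) {x : ℕ → V} {d : ℕ}
    (hx : G.IsGeodesic x d) :
    d = ((Finset.range d).filter fun i => G.IsBridge s(x i, x (i + 1))).card +
      ∑ C ∈ (finite_cycles (G := G)).toFinset,
        ((Finset.range d).filter fun i => C.Adj (x i) (x (i + 1))).card := by
  have h1 : Finset.range d = ((Finset.range d).filter fun i => G.IsBridge s(x i, x (i + 1))) ∪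
      (finite_cycles (G := G)).toFinset.biUnion fun C =>
        (Finset.range d).filter fun i => C.Adj (x i) (x (i + 1)) := by
    ext i
    simp only [Finset.mem_union, Finset.mem_biUnion, Set.Finite.mem_toFinset, Finset.mem_filter,
      Finset.mem_range]
    constructor
    · intro h
      by_cases hb : G.IsBridge s(x i, x (i + 1))
      · exact Or.inl ⟨h, hb⟩
      · obtain ⟨C, hC, h'⟩ := exists_mem_cycles_of_not_isBridge (hx.adj i h) hb
        exact Or.inr ⟨C, hC, h, h'⟩
    · rintro (h | ⟨C, -, h, -⟩)
      · exact h.1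
      · exact h
  conv_lhs => rw [← Finset.card_range d, h1]
  rw [Finset.card_union_of_disjoint, Finset.card_biUnion]
  · intro C hC D hD hne
    rw [Set.Finite.coe_toFinset] at hC hD
    refine Finset.disjoint_left.2 ?_
    intro i hi hi'
    rw [Finset.mem_filter] at hi hi'
    exact hne (hG.cycle_unique hC hD hi.2 hi'.2)
  · rw [Finset.disjoint_left]
    intro i hi hi'
    simp only [Finset.mem_biUnion, Set.Finite.mem_toFinset, Finset.mem_filter] at hi hi'
    obtain ⟨C, hC, h⟩ := hi'
    exact not_isBridge_of_mem_cycles hC (e := s(x i, x (i + 1))) h.2 hi.2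

open Classical in
/-- The leaves off a geodesic and the bridges on it correspond to distinct bridges. -/
theorem card_leaves_add_card_bridges_le [Fintype V] [DecidableRel G.Adj] {x : ℕ → V} {d : ℕ}
    (hx : G.IsGeodesic x d)
    (hl : ∀ x y, G.Adj x y → ¬ (G.degree x = 1 ∧ G.degree y = 1)) :
    (Finset.univ.filter fun v => G.degree v = 1 ∧ v ∉ (Finset.range (d + 1)).image x).card +
      ((Finset.range d).filter fun i => G.IsBridge s(x i, x (i + 1))).card ≤
      G.bridges.ncard := by
  have hnb : ∀ v, ∃ w, G.degree v = 1 → G.Adj v w := fun v => by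
    by_cases h : G.degree v = 1
    · obtain ⟨w, hw⟩ := (G.degree_pos_iff_exists_adj v).1 (by omega)
      exact ⟨w, fun _ => hw⟩
    · exact ⟨v, fun h' => absurd h' h⟩
  choose nb hnb using hnb
  set A := Finset.univ.filter fun v => G.degree v = 1 ∧ v ∉ (Finset.range (d + 1)).image x
  set B := (Finset.range d).filter fun i => G.IsBridge s(x i, x (i + 1))
  have hA : ∀ v ∈ A, G.degree v = 1 ∧ ∀ i ≤ d, x i ≠ v := by
    intro v hv
    simp only [A, Finset.mem_filter, Finset.mem_univ, true_and, Finset.mem_image,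
      Finset.mem_range, not_exists, not_and] at hv
    exact ⟨hv.1, fun i hi => hv.2 i (by omega)⟩
  have h1 : (A.image fun v => s(v, nb v)).card = A.card := by
    refine Finset.card_image_of_injOn fun v hv w hw h => ?_
    rcases Sym2.eq_iff.1 h with ⟨h1, -⟩ | ⟨h1, h2⟩
    · exact h1
    · have hv' := (hA v hv).1
      have := hnb v hv'
      exact absurd ⟨hv', by rw [h2]; exact (hA w hw).1⟩ (hl _ _ this)
  have h2 : (B.image fun i => s(x i, x (i + 1))).card = B.card := by
    refine Finset.card_image_of_injOn fun i hi j hj h => ?_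
    simp only [B, Finset.mem_coe, Finset.mem_filter, Finset.mem_range] at hi hj
    exact hx.edge_injOn hi.1 hj.1 h
  rw [← h1, ← h2, ← Finset.card_union_of_disjoint, Set.ncard_eq_toFinset_card']
  · refine Finset.card_le_card (Finset.union_subset ?_ ?_)
    · intro e he
      obtain ⟨v, hv, rfl⟩ := Finset.mem_image.1 he
      have hv' := (hA v hv).1
      rw [Set.mem_toFinset]
      refine ⟨hnb v hv', ?_⟩
      by_contra hb
      obtain ⟨C, hC, h⟩ := exists_mem_cycles_of_not_isBridge (hnb v hv') hb
      have := two_le_degree_of_mem_cycles hC h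
      omega
    · intro e he
      obtain ⟨i, hi, rfl⟩ := Finset.mem_image.1 he
      simp only [B, Finset.mem_filter, Finset.mem_range] at hi
      rw [Set.mem_toFinset]
      exact ⟨hx.adj i hi.1, hi.2⟩
  · rw [Finset.disjoint_left]
    intro e he he'
    obtain ⟨v, hv, rfl⟩ := Finset.mem_image.1 he
    obtain ⟨i, hi, h⟩ := Finset.mem_image.1 he'
    simp only [B, Finset.mem_filter, Finset.mem_range] at hi
    rcases Sym2.eq_iff.1 h with ⟨h1, -⟩ | ⟨-, h1⟩
    · exact (hA v hv).2 i (by omega) h1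
    · exact (hA v hv).2 (i + 1) (by omega) h1

end SimpleGraph

namespace SimpleGraph

/-! ### Vertex weights along a geodesic -/

/-- Consecutive distinct labels cost: if each change of label between two proper labels is worth
`γ` and each change between a proper label and `none` is worth `β ≥ γ / 2`, then a sequence
starting with a proper label is worth at least `γ` for every further proper label it contains. -/
theorem mul_card_labels_le {α : Type*} [DecidableEq α] (L : ℕ → Option α) (f : ℕ → ℝ) {β γ : ℝ}
    (hγ : 0 ≤ γ) (hβγ : γ ≤ 2 * β) {i j : ℕ} (hi : L i ≠ none)
    (h0 : ∀ t, i ≤ t → t < j → 0 ≤ f (t + 1))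
    (h1 : ∀ t, i ≤ t → t < j → L t = none → L (t + 1) ≠ none → β ≤ f (t + 1))
    (h2 : ∀ t, i ≤ t → t < j → L t ≠ none → L (t + 1) = none → β ≤ f (t + 1))
    (h3 : ∀ t, i ≤ t → t < j → L t ≠ none → L (t + 1) ≠ none → L t ≠ L (t + 1) → γ ≤ f (t + 1))
    (hij : i ≤ j) :
    γ * ((((Finset.Icc i j).image L).erase none).card - 1) + (if L j = none then β else 0) ≤
      ∑ t ∈ Finset.Ico i j, f (t + 1) := by
  induction j, hij using Nat.le_induction with
  | base =>
    have : (Finset.image L (Finset.Icc i i)).erase none = {L i} := by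
      rw [Finset.Icc_self, Finset.image_singleton]
      exact Finset.erase_eq_of_notMem (by simpa using hi.symm)
    rw [this, if_neg hi, Finset.card_singleton]
    simp
  | succ j hij ih =>
    have ih := ih (fun t h h' => h0 t h (by omega)) (fun t h h' => h1 t h (by omega))
      (fun t h h' => h2 t h (by omega)) (fun t h h' => h3 t h (by omega))
    have h0 := h0 j hij (by omega)
    have h1 := h1 j hij (by omega)
    have h2 := h2 j hij (by omega)
    have h3 := h3 j hij (by omega)
    rw [Finset.sum_Ico_succ_top hij]
    have hI : Finset.Icc i (j + 1) = insert (j + 1) (Finset.Icc i j) := by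
      ext t; simp only [Finset.mem_Icc, Finset.mem_insert]; omega
    rw [hI, Finset.image_insert]
    set S := Finset.image L (Finset.Icc i j)
    have hjS : L j ∈ S := Finset.mem_image_of_mem L (Finset.mem_Icc.2 ⟨hij, le_rfl⟩)
    by_cases hn : L (j + 1) = none
    · have : (insert (L (j + 1)) S).erase none = S.erase none := by
        rw [hn, Finset.erase_insert_eq_erase]
      rw [this, if_pos hn]
      split_ifs at ih with hj
      · linarith
      · linarith [h2 hj hn]
    · rw [if_neg hn, Finset.erase_insert_of_ne hn]
      have hle : (((insert (L (j + 1)) (S.erase none)).card : ℕ) : ℝ) ≤ (S.erase none).card + 1 := by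
        exact_mod_cast Finset.card_insert_le _ _
      have hle' := mul_le_mul_of_nonneg_left hle hγ
      split_ifs at ih with hj
      · linarith [h1 hj hn]
      · by_cases he : L j = L (j + 1)
        · rw [← he, Finset.insert_eq_of_mem (Finset.mem_erase.2 ⟨hj, hjS⟩)]
          linarith
        · linarith [h3 hj hn he]

variable {V : Type*} [Fintype V] {G : SimpleGraph V} [DecidableRel G.Adj] {x : ℕ → V} {d : ℕ}

theorem IsGeodesic.two_le_degree (hx : G.IsGeodesic x d) {t : ℕ} (ht : t + 1 < d) :
    2 ≤ G.degree (x (t + 1)) := by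
  refine two_le_degree_of_adj_of_adj (hx.adj t (by omega)).symm (hx.adj (t + 1) ht) fun h => ?_
  have := hx.injOn (by omega) (by omega) h
  omega

/-- The constant is twice the loss at an end of a geodesic that consists of a leaf and a neighbour
of degree `3`. -/
theorem bridge_const_eq :
    -3 + 2 / √3 + 2 * √(2 / 3) =
      2 * (1 / 2 + (√2 / 2 * √((3 : ℕ) : ℝ) + (1 - √2 / 2) / √((3 : ℕ) : ℝ)) - 2) := by
  have h3 : √(3 : ℝ) * √3 = 3 := Real.mul_self_sqrt (by norm_num)
  have h0 : 0 < √(3 : ℝ) := by positivity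
  rw [Real.sqrt_div (by norm_num), Nat.cast_ofNat]
  have h3' : √(3 : ℝ) ^ 2 = 3 := by rw [sq, h3]
  field_simp
  rw [h3']
  ring

theorem bridge_const_bounds :
    -0.2124 < -3 + 2 / √3 + 2 * √(2 / 3) ∧ -3 + 2 / √3 + 2 * √(2 / 3) < -0.2122 := by
  obtain ⟨h1, h2⟩ := sqrt_three_bounds
  obtain ⟨h5, h6⟩ := sqrt_two_bounds
  have h3 : √(3 : ℝ) * √3 = 3 := Real.mul_self_sqrt (by norm_num)
  have h4 : 2 / √3 = 2 / 3 * √3 := by field_simp; linarith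
  have h7 : √(2 / 3) = √2 * √3 / 3 := by
    rw [Real.sqrt_div (by norm_num)]; field_simp; linarith
  rw [h4, h7]
  constructor <;> nlinarith

/-- The end of a geodesic up to the first edge on a cycle: a leaf is compensated by the branching
where the geodesic meets the cycle. -/
theorem IsGeodesic.sum_prefix_ge (hx : G.IsGeodesic x d) (hG : G.Connected) {i : ℕ} (hi : i < d)
    {C : G.Subgraph} (hC : C ∈ G.cycles) (hCi : C.Adj (x i) (x (i + 1)))
    (hb : ∀ t < i, G.IsBridge s(x t, x (t + 1))) :
    (-3 + 2 / √3 + 2 * √(2 / 3)) / 2 ≤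
      ∑ t ∈ Finset.range (i + 1), (G.vertexWeight (x t) - 1) := by
  have hc := bridge_const_bounds.2
  have hpos : ∀ t, t + 1 < d → 0 ≤ G.vertexWeight (x (t + 1)) - 1 := fun t ht =>
    sub_nonneg.2 (one_le_vertexWeight (hx.two_le_degree ht))
  have h3 : i ≠ 0 → 3 ≤ G.degree (x i) := by
    intro h0
    obtain ⟨i, rfl⟩ := Nat.exists_eq_succ_of_ne_zero h0
    refine three_le_degree_of_mem_cycles hC hCi (hx.adj i (by omega)).symm fun h => ?_
    exact not_isBridge_of_mem_cycles hC (e := s(x i, x (i + 1))) h.symm (hb i (by omega))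
  by_cases h0 : 2 ≤ G.degree (x 0)
  · have : 0 ≤ ∑ t ∈ Finset.range (i + 1), (G.vertexWeight (x t) - 1) := by
      refine Finset.sum_nonneg fun t ht => ?_
      rw [Finset.mem_range] at ht
      rcases t with - | t
      · exact sub_nonneg.2 (one_le_vertexWeight h0)
      · exact hpos t (by omega)
    linarith
  have h1 : G.degree (x 0) = 1 := by
    have := hG.one_le_degree hC (x 0)
    omega
  rcases i with - | - | i
  · have := two_le_degree_of_mem_cycles hC hCi
    omega
  · have := leaf_add_vertexWeight_ge (q := 3) (by norm_num) h1 (hx.adj 0 (by omega))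
      (h3 (by norm_num))
    rw [bridge_const_eq, Finset.sum_range_succ, Finset.sum_range_succ, Finset.sum_range_zero]
    linarith
  · have h4 := leaf_add_vertexWeight_ge (q := 2) le_rfl h1 (hx.adj 0 (by omega))
      (hx.two_le_degree (t := 0) (by omega))
    have h5 := vertexWeight_ge (q := 3) (by norm_num) (h3 (by omega))
    have h6 : 0 ≤ ∑ t ∈ Finset.range i, (G.vertexWeight (x (t + 1 + 1)) - 1) :=
      Finset.sum_nonneg fun t ht => hpos (t + 1) (by rw [Finset.mem_range] at ht; omega)
    rw [Finset.sum_range_succ, Finset.sum_range_succ', Finset.sum_range_succ']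
    simp only [Nat.cast_ofNat, zero_add] at h4 h5 ⊢
    obtain ⟨h7, h8⟩ := sqrt_two_bounds
    obtain ⟨h9, h10⟩ := sqrt_three_bounds
    have h11 := sqrt_two_div_two_mul_self
    have h12 : (1 - √2 / 2) / √2 = √2 / 2 - 1 / 2 := by
      field_simp; linarith
    rw [h12] at h4
    have : (√2 / 2) * √3 ≥ 1.2247 := by nlinarith
    linarith

/-- The vertices strictly between the first and the last cycle edge of a geodesic. -/
theorem IsCactus.sum_middle_ge (hG : G.IsCactus) (hx : G.IsGeodesic x d) {i j : ℕ} (hij : i ≤ j)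
    (hj : j < d) (hi : ¬ G.IsBridge s(x i, x (i + 1))) (S : Finset G.Subgraph)
    (hS : ∀ C ∈ S, C ∈ G.cycles ∧ ∃ t, i ≤ t ∧ t ≤ j ∧ C.Adj (x t) (x (t + 1))) :
    (√2 - 1) * ((S.card : ℝ) - 1) ≤ ∑ t ∈ Finset.Ico i j, (G.vertexWeight (x (t + 1)) - 1) := by
  classical
  let L : ℕ → Option G.Subgraph := fun t =>
    if h : ∃ C ∈ G.cycles, C.Adj (x t) (x (t + 1)) then some h.choose else none
  have hL1 : ∀ t C, L t = some C → C ∈ G.cycles ∧ C.Adj (x t) (x (t + 1)) := by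
    intro t C h
    by_cases h' : ∃ C ∈ G.cycles, C.Adj (x t) (x (t + 1))
    · simp only [L, dif_pos h', Option.some.injEq] at h
      rw [← h]; exact h'.choose_spec
    · simp [L, dif_neg h'] at h
  have hL2 : ∀ t C, C ∈ G.cycles → C.Adj (x t) (x (t + 1)) → L t = some C := by
    intro t C hC h
    have h' : ∃ C ∈ G.cycles, C.Adj (x t) (x (t + 1)) := ⟨C, hC, h⟩
    simp only [L, dif_pos h']
    rw [hG.cycle_unique h'.choose_spec.1 hC h'.choose_spec.2 h]
  obtain ⟨h7, h8⟩ := sqrt_two_bounds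
  obtain ⟨h9, h10⟩ := sqrt_three_bounds
  -- `0.2247` lies between `(√2 - 1) / 2` and `√(3 / 2) - 1`
  have hthree : ∀ {v}, 3 ≤ G.degree v → (0.2247 : ℝ) ≤ G.vertexWeight v - 1 := by
    intro v h
    have := vertexWeight_ge (q := 3) (by norm_num) h
    rw [Nat.cast_ofNat] at this
    nlinarith
  have hmain := mul_card_labels_le L (fun t => G.vertexWeight (x t) - 1) (β := 0.2247)
    (γ := √2 - 1) (i := i) (j := j) (by linarith) (by linarith) ?_ ?_ ?_ ?_ ?_ hij
  · refine le_trans ?_ hmain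
    have hcard : S.card ≤ (((Finset.Icc i j).image L).erase none).card := by
      refine Finset.card_le_card_of_injOn some (fun C hC => ?_)
        (fun a _ b _ h => Option.some.inj h)
      obtain ⟨hC, t, h1, h2, h3⟩ := hS C hC
      refine Finset.mem_coe.2 (Finset.mem_erase.2 ⟨by simp, ?_⟩)
      exact Finset.mem_image.2 ⟨t, Finset.mem_Icc.2 ⟨h1, h2⟩, hL2 t C hC h3⟩
    have hcard' : (S.card : ℝ) ≤ (((Finset.Icc i j).image L).erase none).card := by
      exact_mod_cast hcard
    have h0 : (0 : ℝ) ≤ if L j = none then 0.2247 else 0 := by split_ifs <;> norm_num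
    nlinarith
  · obtain ⟨C, hC, h⟩ := exists_mem_cycles_of_not_isBridge (hx.adj i (by omega)) hi
    rw [hL2 i C hC h]; simp
  · intro t _ ht
    exact sub_nonneg.2 (one_le_vertexWeight (hx.two_le_degree (by omega)))
  · intro t _ ht h1 h2
    obtain ⟨C, hC⟩ := Option.ne_none_iff_exists'.1 h2
    obtain ⟨hC1, hC2⟩ := hL1 _ C hC
    refine hthree (three_le_degree_of_mem_cycles hC1 hC2 (hx.adj t (by omega)).symm fun h => ?_)
    rw [hL2 t C hC1 h.symm] at h1
    simp at h1
  · intro t _ ht h1 h2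
    obtain ⟨C, hC⟩ := Option.ne_none_iff_exists'.1 h1
    obtain ⟨hC1, hC2⟩ := hL1 _ C hC
    refine hthree (three_le_degree_of_mem_cycles hC1 hC2.symm (hx.adj (t + 1) (by omega))
      fun h => ?_)
    rw [hL2 (t + 1) C hC1 h] at h2
    simp at h2
  · intro t _ ht h1 h2 h3
    obtain ⟨C, hC⟩ := Option.ne_none_iff_exists'.1 h1
    obtain ⟨D, hD⟩ := Option.ne_none_iff_exists'.1 h2
    obtain ⟨hC1, hC2⟩ := hL1 _ C hC
    obtain ⟨hD1, hD2⟩ := hL1 _ D hD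
    have hne : C ≠ D := by rintro rfl; exact h3 (hC.trans hD.symm)
    linarith [sqrt_two_le_vertexWeight (hG.four_le_degree_of_mem_cycles hC1 hD1 hne hC2.symm hD2)]

/-- The weight of a geodesic that meets `s` cycles in at least one edge. -/
theorem IsCactus.sum_geodesic_ge (hG : G.IsCactus) (hx : G.IsGeodesic x d) (S : Finset G.Subgraph)
    (hS : ∀ C ∈ S, C ∈ G.cycles ∧ ∃ t < d, C.Adj (x t) (x (t + 1))) (hne : S.Nonempty)
    {c : ℝ} (hc : c = -3 + 2 / √3 + 2 * √(2 / 3) ∨ c = 0 ∧ ∀ e ∈ G.edgeSet, ¬ G.IsBridge e) :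
    (√2 - 1) * ((S.card : ℝ) - 1) + c ≤
      ∑ t ∈ Finset.range (d + 1), (G.vertexWeight (x t) - 1) := by
  classical
  -- `i` and `j` are the first and the last index of an edge on a cycle
  set I := (Finset.range d).filter fun t => ∃ C ∈ G.cycles, C.Adj (x t) (x (t + 1)) with hI
  have hIne : I.Nonempty := by
    obtain ⟨C, hC⟩ := hne
    obtain ⟨h1, t, h2, h3⟩ := hS C hC
    exact ⟨t, Finset.mem_filter.2 ⟨Finset.mem_range.2 h2, C, h1, h3⟩⟩
  have h1 := I.min'_mem hIne
  have h2 := I.max'_mem hIne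
  have h3 : ∀ t ∈ I, I.min' hIne ≤ t := fun t ht => I.min'_le t ht
  have h4 : ∀ t ∈ I, t ≤ I.max' hIne := fun t ht => I.le_max' t ht
  set i := I.min' hIne
  set j := I.max' hIne
  have hij : i ≤ j := h3 j h2
  rw [hI, Finset.mem_filter, Finset.mem_range] at h1 h2
  obtain ⟨hi, C, hC, hCi⟩ := h1
  obtain ⟨hj, D, hD, hDj⟩ := h2
  have hbr : ∀ t < d, t ∉ I → G.IsBridge s(x t, x (t + 1)) := by
    intro t ht htI
    by_contra hb
    obtain ⟨C, hC, h⟩ := exists_mem_cycles_of_not_isBridge (hx.adj t ht) hb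
    exact htI (Finset.mem_filter.2 ⟨Finset.mem_range.2 ht, C, hC, h⟩)
  have hmid := hG.sum_middle_ge hx hij hj
    (not_isBridge_of_mem_cycles hC (e := s(x i, x (i + 1))) hCi) S fun C hC => by
      obtain ⟨h1, t, h2, h5⟩ := hS C hC
      have ht : t ∈ I := Finset.mem_filter.2 ⟨Finset.mem_range.2 h2, C, h1, h5⟩
      exact ⟨h1, t, h3 t ht, h4 t ht, h5⟩
  have hbi : ∀ t < i, G.IsBridge s(x t, x (t + 1)) := fun t ht =>
    hbr t (by omega) fun h => absurd (h3 t h) (by omega)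
  have hbj : ∀ t < d - 1 - j, G.IsBridge s(x (d - t), x (d - (t + 1))) := fun t ht => by
    have := hbr (d - (t + 1)) (by omega) fun h => absurd (h4 _ h) (by omega)
    rwa [show d - (t + 1) + 1 = d - t by omega, Sym2.eq_swap] at this
  have hDj' : D.Adj (x (d - (d - 1 - j))) (x (d - (d - 1 - j + 1))) := by
    rw [show d - (d - 1 - j) = j + 1 by omega, show d - (d - 1 - j + 1) = j by omega]
    exact hDj.symm
  have hsplit : ∑ t ∈ Finset.range (d + 1), (G.vertexWeight (x t) - 1) =
      ∑ t ∈ Finset.range (i + 1), (G.vertexWeight (x t) - 1) +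
      ∑ t ∈ Finset.Ico i j, (G.vertexWeight (x (t + 1)) - 1) +
      ∑ t ∈ Finset.range (d - 1 - j + 1), (G.vertexWeight (x (d - t)) - 1) := by
    rw [Finset.sum_Ico_add' (fun t => G.vertexWeight (x t) - 1) i j 1,
      Finset.sum_range_add_sum_Ico _ (by omega)]
    have h5 : ∑ t ∈ Finset.range (d - 1 - j + 1), (G.vertexWeight (x (d - t)) - 1) =
        ∑ t ∈ Finset.Ico (j + 1) (d + 1), (G.vertexWeight (x t) - 1) := by
      rw [Finset.range_eq_Ico, Finset.sum_Ico_reflect (fun t => G.vertexWeight (x t) - 1) 0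
        (show d - 1 - j + 1 ≤ d + 1 by omega),
        show d + 1 - (d - 1 - j + 1) = j + 1 by omega, Nat.sub_zero]
    rw [h5, Finset.sum_range_add_sum_Ico _ (by omega)]
  rw [hsplit]
  rcases hc with rfl | ⟨rfl, hnb⟩
  · have h5 := hx.sum_prefix_ge hG.1 hi hC hCi hbi
    have h6 := hx.reverse.sum_prefix_ge hG.1 (show d - 1 - j < d by omega) hD hDj' hbj
    linarith
  · have hi0 : i = 0 := by
      by_contra h
      exact hnb _ (hx.adj 0 (by omega)) (hbi 0 (by omega))
    have hj0 : d - 1 - j = 0 := by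
      by_contra h
      exact hnb _ (hx.reverse.adj 0 (by omega)) (hbj 0 (by omega))
    have h5 := one_le_vertexWeight (two_le_degree_of_mem_cycles hC hCi)
    have h6 := one_le_vertexWeight (two_le_degree_of_mem_cycles hD hDj')
    rw [hi0, hj0, Finset.sum_range_one, Finset.sum_range_one]
    rw [hi0] at h5 hmid
    rw [hj0] at h6
    linarith

/-- A geodesic of positive length, without regard to the cycles it meets. -/
theorem IsGeodesic.sum_ge (hx : G.IsGeodesic x d) (hd : 0 < d) (h1 : ∀ v, 1 ≤ G.degree v)
    (hl : ∀ x y, G.Adj x y → ¬ (G.degree x = 1 ∧ G.degree y = 1)) :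
    -0.8 ≤ ∑ t ∈ Finset.range (d + 1), (G.vertexWeight (x t) - 1) := by
  obtain ⟨h7, h8⟩ := sqrt_two_bounds
  have hlast := half_le_vertexWeight (h1 (x d))
  obtain ⟨e, rfl⟩ := Nat.exists_eq_succ_of_ne_zero hd.ne'
  rcases e with - | e
  · have hfirst := half_le_vertexWeight (h1 (x 0))
    rw [Finset.sum_range_succ, Finset.sum_range_one]
    by_cases h : G.degree (x 0) = 1
    · have h2 : 2 ≤ G.degree (x 1) := by
        have h3 := h1 (x 1)
        have := hl _ _ (hx.adj 0 (by omega))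
        rw [zero_add] at this
        omega
      have := one_le_vertexWeight h2
      linarith
    · have := one_le_vertexWeight (G := G) (x := x 0) (by have := h1 (x 0); omega)
      simp only [Nat.succ_eq_add_one, zero_add] at *
      linarith
  · rw [Finset.sum_range_succ, Finset.sum_range_succ', Finset.sum_range_succ']
    have h6 : 0 ≤ ∑ t ∈ Finset.range e, (G.vertexWeight (x (t + 1 + 1)) - 1) :=
      Finset.sum_nonneg fun t ht => sub_nonneg.2 (one_le_vertexWeight
        (hx.two_le_degree (by rw [Finset.mem_range] at ht; omega)))
    have h2 : 2 ≤ G.degree (x (0 + 1)) := hx.two_le_degree (by omega)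
    by_cases h : G.degree (x 0) = 1
    · have h4 := leaf_add_vertexWeight_ge (q := 2) le_rfl h (hx.adj 0 (by omega)) h2
      have h12 : (1 - √2 / 2) / √2 = √2 / 2 - 1 / 2 := by
        have := sqrt_two_div_two_mul_self
        field_simp; linarith
      rw [Nat.cast_ofNat, h12] at h4
      have := sqrt_two_div_two_mul_self
      simp only [zero_add, Nat.succ_eq_add_one] at *
      linarith
    · have := one_le_vertexWeight (G := G) (x := x 0) (by have := h1 (x 0); omega)
      have := one_le_vertexWeight h2
      simp only [zero_add, Nat.succ_eq_add_one] at *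
      linarith

end SimpleGraph

namespace SimpleGraph

variable {V : Type*} [Fintype V] {G : SimpleGraph V} [DecidableRel G.Adj] {x : ℕ → V} {d : ℕ}

/-! ### The lower bounds -/

theorem IsGeodesic.sum_vertexWeight_ge (hx : G.IsGeodesic x d) (h1 : ∀ v, 1 ≤ G.degree v)
    (hl : ∀ x y, G.Adj x y → ¬ (G.degree x = 1 ∧ G.degree y = 1)) :
    open Classical in
    Fintype.card V + ∑ t ∈ Finset.range (d + 1), (G.vertexWeight (x t) - 1) -
      ((G.bridges.ncard : ℝ) -
        ((Finset.range d).filter fun i => G.IsBridge s(x i, x (i + 1))).card) / 2 ≤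
      ∑ v, G.vertexWeight v := by
  classical
  set P := (Finset.range (d + 1)).image x with hP
  have h2 : ∑ v ∈ P, (G.vertexWeight v - 1) =
      ∑ t ∈ Finset.range (d + 1), (G.vertexWeight (x t) - 1) := by
    refine Finset.sum_image fun i hi j hj h => ?_
    simp only [Finset.coe_range, Set.mem_Iio] at hi hj
    exact hx.injOn (by omega) (by omega) h
  have h3 := Finset.sum_add_sum_compl P (fun v => G.vertexWeight v - 1)
  have h4 : ∑ v, (G.vertexWeight v - 1) = ∑ v, G.vertexWeight v - Fintype.card V := by
    rw [Finset.sum_sub_distrib]; simp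
  have h5 : ∑ v ∈ Pᶜ, (if G.degree v = 1 then (-1 / 2 : ℝ) else 0) ≤
      ∑ v ∈ Pᶜ, (G.vertexWeight v - 1) := by
    refine Finset.sum_le_sum fun v _ => ?_
    split_ifs with h
    · linarith [half_le_vertexWeight (h1 v)]
    · exact sub_nonneg.2 (one_le_vertexWeight (by have := h1 v; omega))
  have h6 := card_leaves_add_card_bridges_le hx hl
  rw [← Finset.sum_filter, Finset.sum_const, nsmul_eq_mul] at h5
  have h7 : Pᶜ.filter (fun v => G.degree v = 1) =
      Finset.univ.filter fun v => G.degree v = 1 ∧ v ∉ (Finset.range (d + 1)).image x := by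
    ext v; simp only [hP, Finset.mem_filter, Finset.mem_compl, Finset.mem_univ, true_and]; tauto
  rw [h7] at h5
  have h8 := (Nat.cast_le (α := ℝ)).2 h6
  push_cast at h8
  linarith

theorem IsCactus.two_mul_length_le [DecidableEq V] (hG : G.IsCactus) (hx : G.IsGeodesic x d) :
    2 * d ≤ G.edgeFinset.card + G.bridges.ncard := by
  classical
  have h1 := hG.length_eq hx
  have h2 := hG.card_edgeFinset_eq
  have h3 := Finset.sum_le_sum fun C (hC : C ∈ (finite_cycles (G := G)).toFinset) =>
    hx.two_mul_card_le ((Set.Finite.mem_toFinset _).1 hC)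
  have h5 : ((Finset.range d).filter fun i => G.IsBridge s(x i, x (i + 1))).card ≤
      G.bridges.ncard := by
    rw [Set.ncard_eq_toFinset_card']
    refine Finset.card_le_card_of_injOn (fun i => s(x i, x (i + 1))) (fun i hi => ?_)
      (fun i hi j hj h => ?_)
    · simp only [Finset.mem_coe, Finset.mem_filter, Finset.mem_range] at hi
      rw [Finset.mem_coe, Set.mem_toFinset]
      exact ⟨hx.adj i hi.1, hi.2⟩
    · simp only [Finset.mem_coe, Finset.mem_filter, Finset.mem_range] at hi hj
      exact hx.edge_injOn hi.1 hj.1 h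
  rw [← Finset.mul_sum] at h3
  omega

/-- The lower bound for `R - d / 2`, with the constant `c` depending on whether there are
bridges. A cycle which the geodesic misses has at least three edges, and so contributes more than
the `√2 - 1` that a cycle on the geodesic contributes. -/
theorem IsCactus.randicIndex_sub_half_ge [DecidableEq V] (hG : G.IsCactus)
    (hx : G.IsGeodesic x d) (hd : 0 < d) (hk : 0 < G.cycles.ncard)
    {c : ℝ} (hc : c = -3 + 2 / √3 + 2 * √(2 / 3) ∨ c = 0 ∧ ∀ e ∈ G.edgeSet, ¬ G.IsBridge e) :
    ((Fintype.card V : ℝ) - G.bridges.ncard) / 4 - ((G.cycles.ncard : ℝ) - 1) * (7 / 4 - √2) + c ≤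
      G.randicIndex - (d : ℝ) / 2 := by
  classical
  obtain ⟨C₀, hC₀⟩ := (Set.ncard_pos (Set.toFinite _)).1 hk
  have hone := hG.1.one_le_degree hC₀
  have hl := fun x y (h : G.Adj x y) => hG.1.not_adjacent_leaves hC₀ h
  have hR := sum_vertexWeight_le_randicIndex hl
  have hW := hx.sum_vertexWeight_ge hone hl
  have hm := (Nat.cast_inj (R := ℝ)).2 hG.card_edgeFinset_add_one
  have hm' := (Nat.cast_inj (R := ℝ)).2 hG.card_edgeFinset_eq
  have hd' := (Nat.cast_inj (R := ℝ)).2 (hG.length_eq hx)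
  push_cast at hm hm' hd'
  set cs := (finite_cycles (G := G)).toFinset with hcs
  have hmem : ∀ {C}, C ∈ cs ↔ C ∈ G.cycles := Set.Finite.mem_toFinset _
  have hkc : G.cycles.ncard = cs.card := Set.ncard_eq_toFinset_card _ _
  let I : G.Subgraph → Finset ℕ := fun C =>
    (Finset.range d).filter fun i => C.Adj (x i) (x (i + 1))
  set S := cs.filter fun C => (I C).Nonempty with hS
  set So := cs.filter fun C => ¬ (I C).Nonempty with hSo
  have hsum : S.card + So.card = cs.card := Finset.card_filter_add_card_filter_not _
  have hterm : ∀ C ∈ cs, (if ¬ (I C).Nonempty then (3 / 4 : ℝ) else 0) ≤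
      (C.edgeSet.ncard : ℝ) / 4 - ((I C).card : ℝ) / 2 := by
    intro C hC
    have h1 := hx.two_mul_card_le (hmem.1 hC)
    have h2 := three_le_ncard_edgeSet (hmem.1 hC)
    have h1' : (2 : ℝ) * (I C).card ≤ C.edgeSet.ncard := by exact_mod_cast h1
    have h2' : (3 : ℝ) ≤ C.edgeSet.ncard := by exact_mod_cast h2
    split_ifs with h
    · linarith
    · rw [Finset.not_nonempty_iff_eq_empty] at h
      rw [h, Finset.card_empty]
      push_cast
      linarith
  have hterms := Finset.sum_le_sum hterm
  rw [← Finset.sum_filter, Finset.sum_const, nsmul_eq_mul, Finset.sum_sub_distrib,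
    ← Finset.sum_div, ← Finset.sum_div] at hterms
  change (So.card : ℝ) * _ ≤ _ at hterms
  have hpath : (√2 - 1) * ((S.card : ℝ) - 1) + c - (3 / 4 - (√2 - 1)) * So.card ≤
      ∑ t ∈ Finset.range (d + 1), (G.vertexWeight (x t) - 1) := by
    obtain ⟨h7, h8⟩ := sqrt_two_bounds
    rcases S.eq_empty_or_nonempty with h | h
    -- if the geodesic consists of bridges, the surplus of a cycle off it makes up for both ends
    · have h1 := hx.sum_ge hd hone hl
      have h2 : (1 : ℝ) ≤ So.card := by
        rw [h, Finset.card_empty] at hsum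
        exact_mod_cast (by omega : 1 ≤ So.card)
      have h3 : c ≤ 0 := by
        rcases hc with rfl | ⟨rfl, -⟩
        · linarith [bridge_const_bounds.2]
        · exact le_rfl
      have h4 : (S.card : ℝ) = 0 := by rw [h]; simp
      have h5 : c ≤ -0.2122 := by
        rcases hc with rfl | ⟨-, hnb⟩
        · exact bridge_const_bounds.2.le
        · exfalso
          obtain ⟨C, hC, hCa⟩ := exists_mem_cycles_of_not_isBridge (hx.adj 0 hd)
            (hnb _ (hx.adj 0 hd))
          have : C ∈ S := Finset.mem_filter.2 ⟨hmem.2 hC, 0,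
            Finset.mem_filter.2 ⟨Finset.mem_range.2 hd, hCa⟩⟩
          rw [h] at this
          simp at this
      rw [h4]
      nlinarith
    · have := hG.sum_geodesic_ge hx S (fun C hC => by
        obtain ⟨h1, t, ht⟩ := Finset.mem_filter.1 hC
        obtain ⟨h2, h3⟩ := Finset.mem_filter.1 ht
        exact ⟨hmem.1 h1, t, Finset.mem_range.1 h2, h3⟩) h hc
      have h2 : (0 : ℝ) ≤ So.card := Nat.cast_nonneg _
      nlinarith
  have hkc' : (G.cycles.ncard : ℝ) = S.card + So.card := by rw [hkc, ← hsum]; push_cast; ring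
  have hd'' : (d : ℝ) = ((Finset.range d).filter fun i => G.IsBridge s(x i, x (i + 1))).card +
    ∑ C ∈ cs, ((I C).card : ℝ) := hd'
  rw [hkc'] at hm ⊢
  have hbal : (√2 - 1) * ((S.card : ℝ) - 1) - (3 / 4 - (√2 - 1)) * So.card =
    (√2 - 1) * ((S.card : ℝ) + So.card - 1) - 3 / 4 * So.card := by ring
  linarith

end SimpleGraph

namespace SimpleGraph

variable {V : Type*} {G : SimpleGraph V}

/-! ### Articulation points and blocks -/

/-- Two edges at `x` which no cycle contains both are separated by `x`. -/
theorem not_reachable_induce_ne {x a b : V} (ha : G.Adj x a) (hb : G.Adj x b) (hab : a ≠ b)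
    (h : ∀ C ∈ G.cycles, ¬ (C.Adj x a ∧ C.Adj x b)) :
    ¬ (G.induce {z | z ≠ x}).Reachable ⟨a, ha.ne'⟩ ⟨b, hb.ne'⟩ := by
  intro hr
  -- the edges at `x` other than `xa` and `xb` are removed
  let H : SimpleGraph V :=
    { Adj := fun u w => G.Adj u w ∧ (u = x → w = a ∨ w = b) ∧ (w = x → u = a ∨ u = b)
      symm := ⟨fun u w h => ⟨h.1.symm, h.2.2, h.2.1⟩⟩
      loopless := ⟨fun u h => G.loopless.irrefl u h.1⟩ }
  have hHa : H.Adj x a := ⟨ha, fun _ => Or.inl rfl, fun h => absurd h.symm ha.ne⟩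
  have hHb : H.Adj x b := ⟨hb, fun _ => Or.inr rfl, fun h => absurd h.symm hb.ne⟩
  have h1 : (H.deleteEdges {s(x, a)}).Reachable a b := by
    refine hr.map (⟨Subtype.val, ?_⟩ : G.induce {z | z ≠ x} →g H.deleteEdges {s(x, a)})
    rintro ⟨u, hu⟩ ⟨w, hw⟩ huw
    rw [deleteEdges_adj]
    refine ⟨⟨huw, fun h => absurd h hu, fun h => absurd h hw⟩, fun h => ?_⟩
    rcases Sym2.eq_iff.1 (Set.mem_singleton_iff.1 h) with ⟨h, -⟩ | ⟨-, h⟩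
    exacts [hu h, hw h]
  have h2 : (H.deleteEdges {s(x, a)}).Adj x b := by
    rw [deleteEdges_adj]
    refine ⟨hHb, fun h => ?_⟩
    rcases Sym2.eq_iff.1 (Set.mem_singleton_iff.1 h) with ⟨-, h⟩ | ⟨h, -⟩
    exacts [hab h.symm, ha.ne h]
  have hHG : H ≤ G := fun u w h => h.1
  obtain ⟨C, hC, hCa, hCH⟩ := exists_mem_cycles_edgeSet_subset hHG hHa
    (h2.reachable.trans h1.symm)
  obtain ⟨z, hz, h3⟩ := exists_other_neighbor hC hCa
  have hxz : s(x, z) ∈ C.edgeSet := (h3 z).2 (Or.inr rfl)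
  have h4 : H.Adj x z := hCH hxz
  rcases h4.2.1 rfl with h5 | h5
  · exact hz h5
  · exact h C hC ⟨hCa, (h3 b).2 (Or.inr h5.symm)⟩

theorem isArticulationPoint_of_adj {x a b : V} (ha : G.Adj x a) (hb : G.Adj x b) (hab : a ≠ b)
    (h : ∀ C ∈ G.cycles, ¬ (C.Adj x a ∧ C.Adj x b)) : G.IsArticulationPoint x :=
  ⟨a, b, ha.ne', hb.ne', ha.symm.reachable.trans hb.reachable,
    not_reachable_induce_ne ha hb hab h⟩

theorem Subgraph.isArticulationPoint_coe_of_adj {H : G.Subgraph} {x a b : V} (ha : H.Adj x a)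
    (hb : H.Adj x b) (hab : a ≠ b) (h : ∀ C ∈ G.cycles, ¬ (C.Adj x a ∧ C.Adj x b)) :
    H.coe.IsArticulationPoint ⟨x, ha.fst_mem⟩ := by
  refine ⟨⟨a, ha.snd_mem⟩, ⟨b, hb.snd_mem⟩, fun h => ha.ne (congrArg Subtype.val h).symm,
    fun h => hb.ne (congrArg Subtype.val h).symm, ha.coe.symm.reachable.trans hb.coe.reachable,
    fun hr => not_reachable_induce_ne ha.adj_sub hb.adj_sub hab h ?_⟩
  exact hr.map (⟨fun z => ⟨z.1.1, fun h => z.2 (Subtype.ext h)⟩, fun h => H.adj_sub h⟩ :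
    H.coe.induce {z | z ≠ ⟨x, ha.fst_mem⟩} →g G.induce {z | z ≠ x})

/-- A connected subgraph without articulation points is a block if no cycle leaves it. -/
theorem isBlock_of_forall_cycles {S : G.Subgraph} (hS : S.Connected)
    (hart : ∀ v : S.verts, ¬ S.coe.IsArticulationPoint v)
    (hnb : ∀ v ∈ S.verts, ∃ w, S.Adj v w)
    (h : ∀ x a b, S.Adj x a → G.Adj x b → ¬ S.Adj x b → ∀ C ∈ G.cycles,
      ¬ (C.Adj x a ∧ C.Adj x b)) : G.IsBlock S := by
  refine ⟨⟨hS, hart⟩, fun H ⟨hH, hHart⟩ hle => ?_⟩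
  have key : ∀ x y, x ∈ S.verts → H.Adj x y → S.Adj x y := by
    intro x y hx hxy
    by_contra hn
    obtain ⟨a, ha⟩ := hnb x hx
    have hne : a ≠ y := by rintro rfl; exact hn ha
    exact hHart _ (Subgraph.isArticulationPoint_coe_of_adj (hle.2 ha) hxy hne
      (h x a y ha hxy.adj_sub hn))
  have hwalk : ∀ (u w : H.verts), H.coe.Walk u w → u.1 ∈ S.verts → w.1 ∈ S.verts := by
    intro u w p
    induction p with
    | nil => exact id
    | cons h p ih => exact fun hu => ih (key _ _ hu h).snd_mem
  obtain ⟨s, hs⟩ := hS.nonempty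
  have hverts : H.verts ⊆ S.verts := fun w hw => by
    obtain ⟨p⟩ := hH.preconnected.coe ⟨s, hle.1 hs⟩ ⟨w, hw⟩
    exact hwalk _ _ p hs
  exact ⟨hverts, fun x y hxy => key x y (hverts hxy.fst_mem) hxy⟩

theorem not_isArticulationPoint_of_mem_cycles {C : G.Subgraph} (hC : C ∈ G.cycles)
    (v : C.verts) : ¬ C.coe.IsArticulationPoint v := by
  classical
  rintro ⟨u, w, hu, hw, -, hn⟩
  refine hn ?_
  obtain ⟨z, p, hp, rfl⟩ := hC
  obtain ⟨v, hv⟩ := v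
  have hv' : v ∈ p.support := p.mem_verts_toSubgraph.1 hv
  set c := p.rotate v hv' with hc
  have hcc : c.IsCycle := (Walk.isCycle_rotate hv').2 hp
  have hcp : c.toSubgraph = p.toSubgraph := p.toSubgraph_rotate hv'
  have hlen := hcc.three_le_length
  have hne : ∀ i, 1 ≤ i → i < c.length → c.getVert i ≠ v := by
    intro i h1 h2 h
    have := (hcc.getVert_endpoint_iff h2.le).1 h
    omega
  have hadj : ∀ i, i < c.length → p.toSubgraph.Adj (c.getVert i) (c.getVert (i + 1)) := by
    intro i hi
    rw [← hcp]
    exact c.toSubgraph_adj_getVert hi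
  have key : ∀ i (h1 : 1 ≤ i) (h2 : i < c.length),
      (p.toSubgraph.coe.induce {z | z ≠ ⟨v, hv⟩}).Reachable
        ⟨⟨c.getVert 1, (hadj 1 (by omega)).fst_mem⟩,
          fun h => hne 1 le_rfl (by omega) (congrArg Subtype.val h)⟩
        ⟨⟨c.getVert i, (hadj i h2).fst_mem⟩, fun h => hne i h1 h2 (congrArg Subtype.val h)⟩ := by
    intro i h1
    induction i, h1 using Nat.le_induction with
    | base => exact fun _ => Reachable.refl _
    | succ i h1 ih =>
      intro h2
      exact (ih (by omega)).trans (Adj.reachable (hadj i (by omega)))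
  have hall : ∀ (y : p.toSubgraph.verts) (hy : y ∈ {z : p.toSubgraph.verts | z ≠ ⟨v, hv⟩}),
      (p.toSubgraph.coe.induce {z | z ≠ ⟨v, hv⟩}).Reachable
        ⟨⟨c.getVert 1, (hadj 1 (by omega)).fst_mem⟩,
          fun h => hne 1 le_rfl (by omega) (congrArg Subtype.val h)⟩ ⟨y, hy⟩ := by
    rintro ⟨y, hy⟩ hyv
    have hyc : y ∈ c.support := by
      rw [← Walk.mem_verts_toSubgraph, hcp]; exact hy
    obtain ⟨i, rfl, hi⟩ := Walk.mem_support_iff_exists_getVert.1 hyc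
    have h0 : i ≠ 0 := by rintro rfl; exact hyv (Subtype.ext c.getVert_zero)
    have h0' : i ≠ c.length := by rintro rfl; exact hyv (Subtype.ext c.getVert_length)
    exact key i (by omega) (by omega)
  exact (hall u hu).symm.trans (hall w hw)

theorem IsCactus.isBlock_of_mem_cycles (hG : G.IsCactus) {C : G.Subgraph} (hC : C ∈ G.cycles) :
    G.IsBlock C := by
  refine isBlock_of_forall_cycles (connected_of_mem_cycles hC)
    (not_isArticulationPoint_of_mem_cycles hC) (fun v hv => exists_adj_of_mem_cycles hC hv) ?_
  rintro x a b ha - hb D hD ⟨hDa, hDb⟩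
  exact hb (hG.cycle_unique hC hD ha hDa ▸ hDb)

theorem isBlock_subgraphOfAdj {a b : V} (hab : G.Adj a b) (hbr : G.IsBridge s(a, b)) :
    G.IsBlock (G.subgraphOfAdj hab) := by
  have hverts : (G.subgraphOfAdj hab).verts = {a, b} := rfl
  have hAdj : ∀ x y, (G.subgraphOfAdj hab).Adj x y ↔ s(a, b) = s(x, y) := fun x y => Iff.rfl
  refine isBlock_of_forall_cycles (Subgraph.subgraphOfAdj_connected hab) ?_ ?_ ?_
  · rintro v ⟨u, w, hu, hw, -, hn⟩
    have : u = w := by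
      have hu' : u.1 ≠ v.1 := fun h => hu (Subtype.ext h)
      have hw' : w.1 ≠ v.1 := fun h => hw (Subtype.ext h)
      have h1 : u.1 = a ∨ u.1 = b := u.2
      have h2 : w.1 = a ∨ w.1 = b := w.2
      have h3 : v.1 = a ∨ v.1 = b := v.2
      refine Subtype.ext ?_
      rcases h1 with h1 | h1 <;> rcases h2 with h2 | h2 <;> rcases h3 with h3 | h3 <;>
        simp_all
    subst this
    exact hn (Reachable.refl _)
  · intro v hv
    rw [hverts] at hv
    rcases hv with rfl | rfl
    · exact ⟨b, rfl⟩
    · exact ⟨a, Sym2.eq_swap⟩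
  · rintro x c e hc - - D hD ⟨hDc, -⟩
    rw [hAdj] at hc
    rw [hc] at hbr
    exact not_isBridge_of_mem_cycles hD (e := s(x, c)) hDc hbr

/-- If the block-cut tree is a path, then no articulation point lies in three blocks. -/
theorem IsPathGraph.not_three_blocks (h : G.bcTree.IsPathGraph) {x : V}
    (hx : G.IsArticulationPoint x) {A B C : G.Subgraph} (hA : G.IsBlock A) (hB : G.IsBlock B)
    (hC : G.IsBlock C) (hxA : x ∈ A.verts) (hxB : x ∈ B.verts) (hxC : x ∈ C.verts) :
    A = B ∨ A = C ∨ B = C := by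
  obtain ⟨m, ⟨e⟩⟩ := h
  have hadj : ∀ (D : G.Subgraph) (hD : G.IsBlock D), x ∈ D.verts →
      (pathGraph m).Adj (e (Sum.inl ⟨x, hx⟩)) (e (Sum.inr ⟨D, hD⟩)) := by
    intro D hD hxD
    rw [e.map_adj_iff, bcTree, fromRel_adj]
    exact ⟨by simp, Or.inl ⟨_, _, rfl, rfl, hxD⟩⟩
  have hinj : ∀ (D E : G.Subgraph) (hD : G.IsBlock D) (hE : G.IsBlock E),
      (e (Sum.inr ⟨D, hD⟩)).val = (e (Sum.inr ⟨E, hE⟩)).val → D = E := by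
    intro D E hD hE h
    have := e.injective (Fin.ext h)
    simpa using this
  have h1 := pathGraph_adj.1 (hadj A hA hxA)
  have h2 := pathGraph_adj.1 (hadj B hB hxB)
  have h3 := pathGraph_adj.1 (hadj C hC hxC)
  have : (e (Sum.inr ⟨A, hA⟩)).val = (e (Sum.inr ⟨B, hB⟩)).val ∨
      (e (Sum.inr ⟨A, hA⟩)).val = (e (Sum.inr ⟨C, hC⟩)).val ∨
      (e (Sum.inr ⟨B, hB⟩)).val = (e (Sum.inr ⟨C, hC⟩)).val := by omega
  exact this.imp (hinj _ _ _ _) (Or.imp (hinj _ _ _ _) (hinj _ _ _ _))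

/-- An end of a diametral path is not an articulation point: a vertex behind it would be
farther away from the other end. -/
theorem Connected.not_isArticulationPoint_of_dist_eq_diam [Finite V] (hG : G.Connected) {u v : V}
    (hd : G.dist u v = G.diam) (huv : v ≠ u) : ¬ G.IsArticulationPoint u := by
  classical
  rintro ⟨a, b, ha, hb, -, hn⟩
  have : Nonempty V := ⟨u⟩
  have hne : G.ediam ≠ ⊤ := connected_iff_ediam_ne_top.1 hG
  have key : ∀ w (hw : w ≠ u), (G.induce {x | x ≠ u}).Reachable ⟨w, hw⟩ ⟨v, huv⟩ := by
    intro w hw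
    obtain ⟨p, hp⟩ := hG.exists_walk_length_eq_dist w v
    have hup : u ∉ p.support := by
      intro hup
      have h1 := congrArg Walk.length (p.take_spec hup)
      rw [Walk.length_append] at h1
      have h2 := dist_le (p.dropUntil u hup)
      have h3 := dist_le (p.takeUntil u hup)
      have h4 := hG.pos_dist_of_ne hw
      have h5 := dist_le_diam hne (u := w) (v := v)
      omega
    exact ⟨p.induce {x | x ≠ u} fun x hx => by rintro rfl; exact hup hx⟩
  exact hn ((key a ha).trans (key b hb).symm)

end SimpleGraph

namespace SimpleGraph

variable {V : Type*} {G : SimpleGraph V}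

/-! ### Longitudinal symmetry along a geodesic -/

/-- The edges of the paths `x 0, …, x d` and `y 0, …, y d`. -/
def pathUnion (x y : ℕ → V) (d : ℕ) : SimpleGraph V :=
  fromEdgeSet {e | ∃ i < d, e = s(x i, x (i + 1)) ∨ e = s(y i, y (i + 1))}

theorem pathUnion_adj {x y : ℕ → V} {d : ℕ} {a b : V} : (pathUnion x y d).Adj a b ↔
    (∃ i < d, s(a, b) = s(x i, x (i + 1)) ∨ s(a, b) = s(y i, y (i + 1))) ∧ a ≠ b := by
  rw [pathUnion, fromEdgeSet_adj]; rfl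

theorem reachable_of_forall_adj {x : ℕ → V} {i j : ℕ} (hij : i ≤ j)
    (h : ∀ t, i ≤ t → t < j → G.Adj (x t) (x (t + 1))) : G.Reachable (x i) (x j) := by
  induction j, hij using Nat.le_induction with
  | base => exact Reachable.refl _
  | succ j hij ih =>
    exact (ih fun t h1 h2 => h t h1 (by omega)).trans (h j hij (by omega)).reachable

theorem pathUnion_le {x y : ℕ → V} {d : ℕ} (hx : G.IsGeodesic x d) (hy : G.IsGeodesic y d) :
    pathUnion x y d ≤ G := by
  intro a b h
  obtain ⟨⟨i, hi, h | h⟩, -⟩ := pathUnion_adj.1 h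
  · rw [← mem_edgeSet, h]; exact hx.adj i hi
  · rw [← mem_edgeSet, h]; exact hy.adj i hi

/-- Two geodesics with the same starting point run through a common vertex simultaneously. -/
theorem IsGeodesic.eq_of_apply_eq {x y : ℕ → V} {d : ℕ} (hx : G.IsGeodesic x d)
    (hy : G.IsGeodesic y d) (h0 : y 0 = x 0) {i j : ℕ} (hi : i ≤ d) (hj : j ≤ d)
    (h : x i = y j) : i = j := by
  have h1 := hx.dist_eq 0 i (Nat.zero_le _) hi
  have h2 := hy.dist_eq 0 j (Nat.zero_le _) hj
  rw [h0, ← h] at h2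
  omega

theorem IsGeodesic.edge_eq_iff {x y : ℕ → V} {d : ℕ} (hx : G.IsGeodesic x d)
    (hy : G.IsGeodesic y d) (h0 : y 0 = x 0) {i j : ℕ} (hi : i < d) (hj : j < d) :
    s(x i, x (i + 1)) = s(y j, y (j + 1)) ↔ i = j ∧ x i = y i ∧ x (i + 1) = y (i + 1) := by
  constructor
  · intro h
    rcases Sym2.eq_iff.1 h with ⟨h1, h2⟩ | ⟨h1, h2⟩
    · obtain rfl := hx.eq_of_apply_eq hy h0 hi.le hj.le h1
      exact ⟨rfl, h1, h2⟩
    · have := hx.eq_of_apply_eq hy h0 hi.le (by omega) h1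
      have := hx.eq_of_apply_eq hy h0 (by omega) hj.le h2
      omega
  · rintro ⟨rfl, h1, h2⟩
    rw [h1, h2]

/-- An edge of only one of two geodesics with the same ends can be bypassed along the other one,
so it lies on a cycle of their union. -/
theorem IsGeodesic.exists_mem_cycles {x y : ℕ → V} {d : ℕ} (hx : G.IsGeodesic x d)
    (hy : G.IsGeodesic y d) (h0 : y 0 = x 0) (h1 : y d = x d) {i : ℕ} (hi : i < d)
    (hne : s(x i, x (i + 1)) ≠ s(y i, y (i + 1))) :
    ∃ C ∈ G.cycles, C.Adj (x i) (x (i + 1)) ∧ C.edgeSet ⊆ (pathUnion x y d).edgeSet := by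
  have hadj : ∀ t < d, (pathUnion x y d).Adj (x t) (x (t + 1)) := fun t ht =>
    pathUnion_adj.2 ⟨⟨t, ht, Or.inl rfl⟩, (hx.adj t ht).ne⟩
  have hdx : ∀ t < d, t ≠ i →
      ((pathUnion x y d).deleteEdges {s(x i, x (i + 1))}).Adj (x t) (x (t + 1)) := by
    intro t ht hti
    rw [deleteEdges_adj]
    exact ⟨hadj t ht, fun h => hti (hx.edge_injOn ht hi (Set.mem_singleton_iff.1 h))⟩
  have hdy : ∀ t < d,
      ((pathUnion x y d).deleteEdges {s(x i, x (i + 1))}).Adj (y t) (y (t + 1)) := by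
    intro t ht
    rw [deleteEdges_adj]
    refine ⟨pathUnion_adj.2 ⟨⟨t, ht, Or.inr rfl⟩, (hy.adj t ht).ne⟩, fun h => hne ?_⟩
    have h' := (Set.mem_singleton_iff.1 h).symm
    obtain ⟨rfl, -⟩ := (hx.edge_eq_iff hy h0 hi ht).1 h'
    exact h'
  have h2 := reachable_of_forall_adj (Nat.zero_le i) fun t _ h => hdx t (by omega) (by omega)
  have h3 := reachable_of_forall_adj (Nat.zero_le d) fun t _ h => hdy t h
  have h4 := reachable_of_forall_adj (show i + 1 ≤ d by omega)
    fun t h h' => hdx t h' (by omega)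
  rw [h0, h1] at h3
  exact exists_mem_cycles_edgeSet_subset (pathUnion_le hx hy) (hadj i hi)
    (h2.symm.trans (h3.trans h4.symm))

/-- Every edge lies in a block which is a cycle or consists of that edge alone. -/
theorem IsCactus.exists_isBlock (hG : G.IsCactus) {a b : V} (hab : G.Adj a b) :
    ∃ B : G.Subgraph, G.IsBlock B ∧ B.Adj a b ∧
      (B ∈ G.cycles ∨ (∀ c e, B.Adj c e → s(a, b) = s(c, e)) ∧ ∀ v ∈ B.verts, v = a ∨ v = b) := by
  by_cases hb : G.IsBridge s(a, b)
  · exact ⟨_, isBlock_subgraphOfAdj hab hb, rfl, Or.inr ⟨fun c e h => h, fun v hv => hv⟩⟩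
  · obtain ⟨C, hC, hCa⟩ := exists_mem_cycles_of_not_isBridge hab hb
    exact ⟨C, hG.isBlock_of_mem_cycles hC, hCa, Or.inl hC⟩

/-- A geodesic whose ends are fixed by an involutive automorphism `σ` that preserves every block
and moves a vertex of every cycle, in a cactus whose block-cut tree is a path. -/
structure IsReflectionAxis (G : SimpleGraph V) (σ : G ≃g G) (x : ℕ → V) (d : ℕ) : Prop where
  cactus : G.IsCactus
  geodesic : G.IsGeodesic x d
  involutive : Function.Involutive σ
  fix_zero : σ (x 0) = x 0
  fix_end : σ (x d) = x d
  image_block : ∀ B : G.Subgraph, G.IsBlock B → σ '' B.verts = B.verts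
  moves_cycle : ∀ C ∈ G.cycles, ∃ v ∈ C.verts, σ v ≠ v
  isPathGraph : G.bcTree.IsPathGraph
  start_not_cut : ¬ G.IsArticulationPoint (x 0)
  end_not_cut : ¬ G.IsArticulationPoint (x d)

namespace IsReflectionAxis

variable {σ : G ≃g G} {x : ℕ → V} {d : ℕ}

theorem reverse (h : G.IsReflectionAxis σ x d) :
    G.IsReflectionAxis σ (fun i => x (d - i)) d where
  cactus := h.cactus
  geodesic := h.geodesic.reverse
  involutive := h.involutive
  fix_zero := h.fix_end
  fix_end := by simpa using h.fix_zero
  image_block := h.image_block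
  moves_cycle := h.moves_cycle
  isPathGraph := h.isPathGraph
  start_not_cut := h.end_not_cut
  end_not_cut := by simpa using h.start_not_cut

theorem image_geodesic (h : G.IsReflectionAxis σ x d) : G.IsGeodesic (fun i => σ (x i)) d := by
  refine h.cactus.1.isGeodesic (fun i hi => σ.map_adj_iff.2 (h.geodesic.adj i hi)) ?_
  rw [h.fix_zero, h.fix_end, h.geodesic.dist_eq 0 d (Nat.zero_le _) le_rfl, Nat.sub_zero]

theorem apply_mem_of_isBlock (h : G.IsReflectionAxis σ x d) {B : G.Subgraph} (hB : G.IsBlock B)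
    {v : V} (hv : v ∈ B.verts) : σ v ∈ B.verts := by
  rw [← h.image_block B hB]
  exact Set.mem_image_of_mem _ hv

theorem map_cycle_adj (h : G.IsReflectionAxis σ x d) {C : G.Subgraph} (hC : C ∈ G.cycles)
    {a b : V} (hab : C.Adj a b) : C.Adj (σ a) (σ b) := by
  have hB := h.cactus.isBlock_of_mem_cycles hC
  exact h.cactus.adj_of_mem_verts hC (h.apply_mem_of_isBlock hB hab.fst_mem)
    (h.apply_mem_of_isBlock hB hab.snd_mem) (σ.map_adj_iff.2 hab.adj_sub)

/-- The reflection fixes no edge of a cycle pointwise, for otherwise it would fix the second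
neighbours as well, and hence the whole cycle. -/
theorem apply_ne (h : G.IsReflectionAxis σ x d) {C : G.Subgraph} (hC : C ∈ G.cycles)
    {a b : V} (hab : C.Adj a b) (ha : σ a = a) : σ b ≠ b := by
  intro hb
  have step : ∀ {u w}, C.Adj u w → σ u = u → σ w = w → ∀ z, C.Adj u z → σ z = z := by
    intro u w huw hu hw z hz
    obtain ⟨t, ht, h1⟩ := exists_other_neighbor hC huw
    rcases (h1 z).1 hz with rfl | rfl
    · exact hw
    · have h2 := h.map_cycle_adj hC hz
      rw [hu] at h2
      rcases (h1 _).1 h2 with h3 | h3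
      · exact absurd (σ.injective (h3.trans hw.symm)) ht
      · exact h3
  have hwalk : ∀ (u w : C.verts), C.coe.Walk u w →
      (σ u.1 = u.1 ∧ ∀ z, C.Adj u.1 z → σ z = z) → σ w.1 = w.1 := by
    intro u w p
    induction p with
    | nil => exact fun h => h.1
    | cons hadj p ih =>
      intro hu
      refine ih ⟨hu.2 _ hadj, ?_⟩
      exact step (Subgraph.Adj.symm hadj) (hu.2 _ hadj) hu.1
  obtain ⟨v, hv, hne⟩ := h.moves_cycle C hC
  obtain ⟨p⟩ := (connected_of_mem_cycles hC).preconnected.coe ⟨a, hab.fst_mem⟩ ⟨v, hv⟩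
  exact hne (hwalk _ _ p ⟨ha, step hab ha hb⟩)

/-- On the axis the edges of cycles are moved and the bridges are fixed. -/
theorem isBridge_iff (h : G.IsReflectionAxis σ x d) {i : ℕ} (hi : i < d) :
    G.IsBridge s(x i, x (i + 1)) ↔ σ (x i) = x i ∧ σ (x (i + 1)) = x (i + 1) := by
  constructor
  · intro hb
    by_contra hn
    obtain ⟨C, hC, hCi, -⟩ := h.geodesic.exists_mem_cycles h.image_geodesic h.fix_zero h.fix_end hi
      fun he => hn (by
        obtain ⟨-, h1, h2⟩ := (h.geodesic.edge_eq_iff h.image_geodesic h.fix_zero hi hi).1 he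
        exact ⟨h1.symm, h2.symm⟩)
    exact not_isBridge_of_mem_cycles hC (e := s(x i, x (i + 1))) hCi hb
  · rintro ⟨h1, h2⟩
    by_contra hb
    obtain ⟨C, hC, hCi⟩ := exists_mem_cycles_of_not_isBridge (h.geodesic.adj i hi) hb
    exact h.apply_ne hC hCi h1 h2

theorem edgeSet_subset (h : G.IsReflectionAxis σ x d) {C : G.Subgraph} (hC : C ∈ G.cycles) {i : ℕ}
    (hi : i < d) (hCi : C.Adj (x i) (x (i + 1))) :
    C.edgeSet ⊆ (pathUnion x (fun i => σ (x i)) d).edgeSet := by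
  obtain ⟨D, hD, hDi, hsub⟩ := h.geodesic.exists_mem_cycles h.image_geodesic h.fix_zero h.fix_end
    hi fun he => by
      obtain ⟨-, h1, h2⟩ := (h.geodesic.edge_eq_iff h.image_geodesic h.fix_zero hi hi).1 he
      exact h.apply_ne hC hCi h1.symm h2.symm
  rwa [h.cactus.cycle_unique hC hD hCi hDi]

theorem pathUnion_map_adj (h : G.IsReflectionAxis σ x d) {a b : V}
    (hab : (pathUnion x (fun i => σ (x i)) d).Adj a b) :
    (pathUnion x (fun i => σ (x i)) d).Adj (σ a) (σ b) := by
  obtain ⟨⟨i, hi, hab⟩, hne⟩ := pathUnion_adj.1 hab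
  refine pathUnion_adj.2 ⟨⟨i, hi, ?_⟩, fun h' => hne (σ.injective h')⟩
  rcases hab with hab | hab
  · right
    simpa only [Sym2.map_mk] using congrArg (Sym2.map σ) hab
  · left
    have := congrArg (Sym2.map σ) hab
    simpa only [Sym2.map_mk, h.involutive _] using this

/-- All edges at the axis belong to the axis or its mirror image: an interior vertex with
a further edge would be an articulation point in three blocks, or the axis would pass through
it within one cycle, whose edges at that vertex would then be fixed. -/
theorem pathUnion_adj_of_adj_axis (h : G.IsReflectionAxis σ x d) (hd : 0 < d) {i : ℕ}
    (hi : i ≤ d) {b : V} (hb : G.Adj (x i) b) :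
    (pathUnion x (fun i => σ (x i)) d).Adj (x i) b := by
  by_contra hn
  have hax : ∀ t < d, (pathUnion x (fun i => σ (x i)) d).Adj (x t) (x (t + 1)) := fun t ht =>
    pathUnion_adj.2 ⟨⟨t, ht, Or.inl rfl⟩, (h.geodesic.adj t ht).ne⟩
  have hnext : ∀ C ∈ G.cycles, i < d → C.Adj (x i) (x (i + 1)) → ¬ C.Adj (x i) b :=
    fun C hC hi h1 h2 => hn (h.edgeSet_subset hC hi h1 (Subgraph.mem_edgeSet.2 h2))
  have hprev : ∀ C ∈ G.cycles, ∀ j, j + 1 = i → C.Adj (x i) (x j) → ¬ C.Adj (x i) b := by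
    rintro C hC j rfl h1 h2
    exact hn (h.edgeSet_subset hC (by omega) h1.symm (Subgraph.mem_edgeSet.2 h2))
  have hbnext : i < d → x (i + 1) ≠ b := by
    rintro hi rfl
    exact hn (hax i hi)
  have hbprev : ∀ j, j + 1 = i → x j ≠ b := by
    rintro j rfl rfl
    exact hn (hax j (by omega)).symm
  rcases Nat.eq_zero_or_pos i with rfl | h0
  · exact h.start_not_cut (isArticulationPoint_of_adj (h.geodesic.adj 0 hd) hb (hbnext hd)
      fun C hC h' => hnext C hC hd h'.1 h'.2)
  obtain ⟨j, rfl⟩ : ∃ j, j + 1 = i := ⟨i - 1, by omega⟩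
  have hj := (h.geodesic.adj j (by omega)).symm
  have hcut : G.IsArticulationPoint (x (j + 1)) :=
    isArticulationPoint_of_adj hj hb (hbprev j rfl) fun C hC h' => hprev C hC j rfl h'.1 h'.2
  rcases hi.eq_or_lt with rfl | hi
  · exact h.end_not_cut hcut
  have hne : x j ≠ x (j + 1 + 1) := fun h' => by
    have := h.geodesic.injOn (by omega) (by omega) h'
    omega
  obtain ⟨A, hA, hAj, hA'⟩ := h.cactus.exists_isBlock hj
  obtain ⟨B, hB, hBj, hB'⟩ := h.cactus.exists_isBlock (h.geodesic.adj (j + 1) hi)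
  obtain ⟨C, hC, hCb, hC'⟩ := h.cactus.exists_isBlock hb
  rcases h.isPathGraph.not_three_blocks hcut hA hB hC hAj.fst_mem hBj.fst_mem hCb.fst_mem with
    rfl | rfl | rfl
  · rcases hA' with hA' | hA'
    · have hfix : σ (x (j + 1)) = x (j + 1) := by
        have h1 := h.apply_mem_of_isBlock hA hAj.fst_mem
        have h2 := h.apply_mem_of_isBlock hC hCb.fst_mem
        rcases hC' with hC' | hC'
        · have hAC : A ≠ C := by
            rintro rfl
            exact hprev _ hA' j rfl hAj hCb
          exact h.cactus.2 A hA' C hC' hAC ⟨h1, h2⟩ ⟨hAj.fst_mem, hCb.fst_mem⟩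
        · rcases hC'.2 _ h2 with h4 | h4
          · exact h4
          · rw [h4] at h1
            exact absurd (h.cactus.adj_of_mem_verts hA' hAj.fst_mem h1 hb)
              (hprev A hA' j rfl hAj)
      have h1 := h.map_cycle_adj hA' hAj
      rw [hfix] at h1
      obtain ⟨z, hz, h2⟩ := exists_other_neighbor hA' hAj
      have h3 : x (j + 1 + 1) = z := ((h2 _).1 hBj).resolve_left hne.symm
      rcases (h2 _).1 h1 with h4 | h4
      · exact h.apply_ne hA' hAj hfix h4
      · rw [← h3] at h4
        have := h.geodesic.eq_of_apply_eq h.image_geodesic h.fix_zero (by omega) (by omega) h4.symm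
        omega
    · rcases Sym2.eq_iff.1 (hA'.1 _ _ hBj) with ⟨-, h1⟩ | ⟨-, h1⟩
      · exact hne h1
      · exact hj.ne h1.symm
  · rcases hA' with hA' | hA'
    · exact hprev _ hA' j rfl hAj hCb
    · rcases Sym2.eq_iff.1 (hA'.1 _ _ hCb) with ⟨-, h1⟩ | ⟨-, h1⟩
      · exact hbprev j rfl h1
      · exact hj.ne h1.symm
  · rcases hB' with hB' | hB'
    · exact hnext _ hB' hi hBj hCb
    · rcases Sym2.eq_iff.1 (hB'.1 _ _ hCb) with ⟨-, h1⟩ | ⟨-, h1⟩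
      · exact hbnext hi h1
      · exact (h.geodesic.adj (j + 1) hi).ne h1.symm

end IsReflectionAxis

end SimpleGraph

namespace SimpleGraph

variable {V : Type*} {G : SimpleGraph V}

namespace IsReflectionAxis

variable {σ : G ≃g G} {x : ℕ → V} {d : ℕ}

theorem exists_eq_or_eq (h : G.IsReflectionAxis σ x d) (hd : 0 < d) (v : V) :
    ∃ i ≤ d, v = x i ∨ v = σ (x i) := by
  have hmem : ∀ {a b}, (pathUnion x (fun i => σ (x i)) d).Adj a b →
      ∃ i ≤ d, b = x i ∨ b = σ (x i) := by
    intro a b hab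
    obtain ⟨⟨i, hi, h' | h'⟩, -⟩ := pathUnion_adj.1 hab
    · rcases Sym2.eq_iff.1 h' with ⟨-, h1⟩ | ⟨-, h1⟩
      exacts [⟨i + 1, hi, Or.inl h1⟩, ⟨i, hi.le, Or.inl h1⟩]
    · rcases Sym2.eq_iff.1 h' with ⟨-, h1⟩ | ⟨-, h1⟩
      exacts [⟨i + 1, hi, Or.inr h1⟩, ⟨i, hi.le, Or.inr h1⟩]
  have hstep : ∀ a b, G.Adj a b → (∃ i ≤ d, a = x i ∨ a = σ (x i)) →
      ∃ i ≤ d, b = x i ∨ b = σ (x i) := by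
    rintro a b hab ⟨i, hi, rfl | rfl⟩
    · exact hmem (h.pathUnion_adj_of_adj_axis hd hi hab)
    · have h1 := σ.map_adj_iff.2 hab
      rw [h.involutive] at h1
      have h2 := h.pathUnion_map_adj (h.pathUnion_adj_of_adj_axis hd hi h1)
      rw [h.involutive] at h2
      exact hmem h2
  have hwalk : ∀ a b, G.Walk a b → (∃ i ≤ d, a = x i ∨ a = σ (x i)) →
      ∃ i ≤ d, b = x i ∨ b = σ (x i) := by
    intro a b p
    induction p with
    | nil => exact id
    | cons hab p ih => exact fun ha => ih (hstep _ _ hab ha)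
  obtain ⟨p⟩ := h.cactus.1.preconnected (x 0) v
  exact hwalk _ _ p ⟨0, Nat.zero_le _, Or.inl rfl⟩

/-- The axis and its mirror image cover the graph. -/
theorem pathUnion_eq (h : G.IsReflectionAxis σ x d) (hd : 0 < d) :
    pathUnion x (fun i => σ (x i)) d = G := by
  refine le_antisymm (pathUnion_le h.geodesic h.image_geodesic) fun a b hab => ?_
  obtain ⟨i, hi, rfl | rfl⟩ := h.exists_eq_or_eq hd a
  · exact h.pathUnion_adj_of_adj_axis hd hi hab
  · have h1 := σ.map_adj_iff.2 hab
    rw [h.involutive] at h1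
    have h2 := h.pathUnion_map_adj (h.pathUnion_adj_of_adj_axis hd hi h1)
    rwa [h.involutive] at h2

/-- The axis and its mirror image have exactly the bridges in common. -/
theorem card_edgeFinset_add [Fintype V] [Fintype G.edgeSet] (h : G.IsReflectionAxis σ x d)
    (hd : 0 < d) : G.edgeFinset.card + G.bridges.ncard = 2 * d := by
  classical
  set X := (Finset.range d).image fun i => s(x i, x (i + 1)) with hX
  set Y := (Finset.range d).image fun i => s(σ (x i), σ (x (i + 1))) with hY
  have hXc : X.card = d := by
    rw [hX, Finset.card_image_of_injOn, Finset.card_range]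
    intro i hi j hj
    simp only [Finset.coe_range, Set.mem_Iio] at hi hj
    exact h.geodesic.edge_injOn hi hj
  have hYc : Y.card = d := by
    rw [hY, Finset.card_image_of_injOn, Finset.card_range]
    intro i hi j hj
    simp only [Finset.coe_range, Set.mem_Iio] at hi hj
    exact h.image_geodesic.edge_injOn hi hj
  have hunion : G.edgeFinset = X ∪ Y := by
    ext e
    induction e with | h a b => ?_
    rw [mem_edgeFinset, mem_edgeSet, ← h.pathUnion_eq hd]
    simp only [pathUnion_adj, hX, hY, Finset.mem_union, Finset.mem_image, Finset.mem_range]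
    constructor
    · rintro ⟨⟨i, hi, h' | h'⟩, -⟩
      exacts [Or.inl ⟨i, hi, h'.symm⟩, Or.inr ⟨i, hi, h'.symm⟩]
    · intro h'
      have hab : G.Adj a b := by
        rcases h' with ⟨i, hi, h'⟩ | ⟨i, hi, h'⟩
        · rw [← mem_edgeSet, ← h']; exact h.geodesic.adj i hi
        · rw [← mem_edgeSet, ← h']; exact h.image_geodesic.adj i hi
      refine ⟨?_, hab.ne⟩
      rcases h' with ⟨i, hi, h'⟩ | ⟨i, hi, h'⟩
      exacts [⟨i, hi, Or.inl h'.symm⟩, ⟨i, hi, Or.inr h'.symm⟩]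
  have hfix : ∀ i < d, G.IsBridge s(x i, x (i + 1)) ↔
      s(x i, x (i + 1)) = s(σ (x i), σ (x (i + 1))) := by
    intro i hi
    rw [h.isBridge_iff hi,
      h.geodesic.edge_eq_iff h.image_geodesic h.fix_zero hi hi]
    simp only [true_and, eq_comm]
  have hinter : G.bridges = ((X ∩ Y : Finset (Sym2 V)) : Set (Sym2 V)) := by
    ext e
    constructor
    · rintro ⟨he, hb⟩
      rw [← mem_edgeFinset, hunion, Finset.mem_union] at he
      rw [Finset.mem_coe, Finset.mem_inter]
      rcases he with he | he
      · refine ⟨he, ?_⟩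
        obtain ⟨i, hi, rfl⟩ := Finset.mem_image.1 he
        rw [(hfix i (Finset.mem_range.1 hi)).1 hb]
        exact Finset.mem_image.2 ⟨i, hi, rfl⟩
      · refine ⟨?_, he⟩
        obtain ⟨i, hi, rfl⟩ := Finset.mem_image.1 he
        have hi' := Finset.mem_range.1 hi
        have : G.IsBridge s(x i, x (i + 1)) := by
          by_contra hn
          obtain ⟨C, hC, hCi⟩ := exists_mem_cycles_of_not_isBridge (h.geodesic.adj i hi') hn
          exact not_isBridge_of_mem_cycles hC (e := s(σ (x i), σ (x (i + 1))))
            (h.map_cycle_adj hC hCi) hb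
        rw [← (hfix i hi').1 this]
        exact Finset.mem_image.2 ⟨i, hi, rfl⟩
    · intro he
      rw [Finset.mem_coe, Finset.mem_inter] at he
      obtain ⟨i, hi, rfl⟩ := Finset.mem_image.1 he.1
      obtain ⟨j, hj, h'⟩ := Finset.mem_image.1 he.2
      rw [Finset.mem_range] at hi hj
      refine ⟨h.geodesic.adj i hi, (hfix i hi).2 ?_⟩
      obtain ⟨rfl, -, -⟩ :=
        (h.geodesic.edge_eq_iff h.image_geodesic h.fix_zero hi hj).1 h'.symm
      exact h'.symm
  have h1 := Finset.card_union_add_card_inter X Y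
  rw [hinter, Set.ncard_coe_finset, hunion]
  omega

/-- The neighbours of a vertex of the axis. -/
theorem eq_of_adj (h : G.IsReflectionAxis σ x d) (hd : 0 < d) {i : ℕ} (hi : i ≤ d) {b : V}
    (hb : G.Adj (x i) b) : ∃ j ≤ d, (j = i + 1 ∨ j + 1 = i) ∧
      (b = x j ∨ σ (x i) = x i ∧ b = σ (x j)) := by
  rw [← h.pathUnion_eq hd] at hb
  obtain ⟨⟨j, hj, h' | h'⟩, -⟩ := pathUnion_adj.1 hb
  · rcases Sym2.eq_iff.1 h' with ⟨h1, h2⟩ | ⟨h1, h2⟩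
    · obtain rfl := h.geodesic.injOn hi hj.le h1
      exact ⟨i + 1, hj, Or.inl rfl, Or.inl h2⟩
    · obtain rfl := h.geodesic.injOn hi (by omega) h1
      exact ⟨j, hj.le, Or.inr rfl, Or.inl h2⟩
  · rcases Sym2.eq_iff.1 h' with ⟨h1, h2⟩ | ⟨h1, h2⟩
    · obtain rfl := h.geodesic.eq_of_apply_eq h.image_geodesic h.fix_zero hi hj.le h1
      exact ⟨i + 1, hj, Or.inl rfl, Or.inr ⟨h1.symm, h2⟩⟩
    · obtain rfl := h.geodesic.eq_of_apply_eq h.image_geodesic h.fix_zero hi (by omega) h1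
      exact ⟨j, hj.le, Or.inr rfl, Or.inr ⟨h1.symm, h2⟩⟩

theorem disjoint_neighbors [DecidableEq V] (h : G.IsReflectionAxis σ x d) {i : ℕ}
    (hi : i + 1 < d) :
    Disjoint ({x i, σ (x i)} : Finset V) {x (i + 2), σ (x (i + 2))} := by
  have h1 : ∀ {j k}, j ≤ d → k ≤ d → x j = x k → j = k := fun hj hk => h.geodesic.injOn hj hk
  have h2 : ∀ {j k}, j ≤ d → k ≤ d → x j = σ (x k) → j = k := fun hj hk =>
    h.geodesic.eq_of_apply_eq h.image_geodesic h.fix_zero hj hk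
  have h3 : ∀ {j k}, j ≤ d → k ≤ d → σ (x j) = σ (x k) → j = k := fun hj hk h' =>
    h1 hj hk (σ.injective h')
  rw [Finset.disjoint_left]
  simp only [Finset.mem_insert, Finset.mem_singleton]
  rintro b (rfl | rfl) (h' | h')
  · have := h1 (by omega) (by omega) h'; omega
  · have := h2 (by omega) (by omega) h'; omega
  · have := h2 (by omega) (by omega) h'.symm; omega
  · have := h3 (by omega) (by omega) h'; omega

section Degree

variable [Fintype V] [DecidableRel G.Adj]

theorem degree_apply (v : V) : G.degree (σ v) = G.degree v := σ.degree_eq v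

theorem neighborFinset_of_fixed [DecidableEq V] (h : G.IsReflectionAxis σ x d) {i : ℕ}
    (hi : i + 1 < d) (hf : σ (x (i + 1)) = x (i + 1)) :
    G.neighborFinset (x (i + 1)) = {x i, σ (x i)} ∪ {x (i + 2), σ (x (i + 2))} := by
  have h1 := (h.geodesic.adj i (by omega)).symm
  have h2 := h.geodesic.adj (i + 1) hi
  have h3 := σ.map_adj_iff.2 h1
  have h4 := σ.map_adj_iff.2 h2
  rw [hf] at h3 h4
  ext b
  simp only [mem_neighborFinset, Finset.mem_union, Finset.mem_insert, Finset.mem_singleton]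
  constructor
  · intro hb
    obtain ⟨j, -, rfl | h6, h5⟩ := h.eq_of_adj (by omega) hi.le hb
    · right
      exact h5.imp_right And.right
    · left
      obtain rfl : j = i := by omega
      exact h5.imp_right And.right
  · rintro ((rfl | rfl) | (rfl | rfl)) <;> assumption

theorem degree_of_moved (h : G.IsReflectionAxis σ x d) {i : ℕ} (hi : i ≤ d)
    (hf : σ (x i) ≠ x i) : G.degree (x i) = 2 := by
  classical
  have h0 : i ≠ 0 := by rintro rfl; exact hf h.fix_zero
  have hd : i ≠ d := by rintro rfl; exact hf h.fix_end
  obtain ⟨i, rfl⟩ := Nat.exists_eq_succ_of_ne_zero h0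
  refine le_antisymm ?_ (h.geodesic.two_le_degree (by omega))
  have : G.neighborFinset (x (i + 1)) ⊆ {x i, x (i + 2)} := by
    intro b hb
    rw [mem_neighborFinset] at hb
    obtain ⟨j, -, h1, h2⟩ := h.eq_of_adj (by omega) hi hb
    have h3 := h2.resolve_right fun h => hf h.1
    rw [h3]
    rcases h1 with rfl | h1
    · simp
    · obtain rfl : j = i := by omega
      simp
  rw [Nat.succ_eq_add_one, ← card_neighborFinset_eq_degree]
  exact (Finset.card_le_card this).trans Finset.card_le_two

theorem degree_of_fixed (h : G.IsReflectionAxis σ x d) {i : ℕ} (hi : i + 1 < d)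
    (hf : σ (x (i + 1)) = x (i + 1)) (h1 : ¬ G.IsBridge s(x i, x (i + 1)))
    (h2 : ¬ G.IsBridge s(x (i + 1), x (i + 2))) : G.degree (x (i + 1)) = 4 := by
  classical
  rw [h.isBridge_iff (by omega), not_and_or] at h1
  rw [h.isBridge_iff hi, not_and_or] at h2
  rw [← card_neighborFinset_eq_degree, h.neighborFinset_of_fixed hi hf,
    Finset.card_union_of_disjoint (h.disjoint_neighbors hi),
    Finset.card_pair (Ne.symm (h1.resolve_right (not_not.2 hf))),
    Finset.card_pair (Ne.symm (h2.resolve_left (not_not.2 hf)))]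

theorem degree_of_isBridge (h : G.IsReflectionAxis σ x d) {i : ℕ} (hi : i + 1 < d)
    (h1 : G.IsBridge s(x i, x (i + 1)))
    (h2 : ¬ G.IsBridge s(x (i + 1), x (i + 2))) : G.degree (x (i + 1)) = 3 := by
  classical
  obtain ⟨h1, hf⟩ := (h.isBridge_iff (by omega)).1 h1
  rw [h.isBridge_iff hi, not_and_or] at h2
  rw [← card_neighborFinset_eq_degree, h.neighborFinset_of_fixed hi hf,
    Finset.card_union_of_disjoint (h.disjoint_neighbors hi), h1,
    Finset.card_pair (Ne.symm (h2.resolve_left (not_not.2 hf)))]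
  simp

theorem degree_zero (h : G.IsReflectionAxis σ x d) (hd : 0 < d)
    (h1 : ¬ G.IsBridge s(x 0, x 1)) : G.degree (x 0) = 2 := by
  classical
  have h2 := h.geodesic.adj 0 hd
  have h3 := σ.map_adj_iff.2 h2
  rw [h.fix_zero] at h3
  rw [h.isBridge_iff hd, not_and_or] at h1
  have : G.neighborFinset (x 0) = {x 1, σ (x 1)} := by
    ext b
    simp only [mem_neighborFinset, Finset.mem_insert, Finset.mem_singleton]
    constructor
    · intro hb
      obtain ⟨j, -, rfl | h6, h5⟩ := h.eq_of_adj hd (Nat.zero_le _) hb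
      · exact h5.imp_right And.right
      · omega
    · rintro (rfl | rfl) <;> assumption
  rw [← card_neighborFinset_eq_degree, this,
    Finset.card_pair (Ne.symm (h1.resolve_left (not_not.2 h.fix_zero)))]

theorem degree_end (h : G.IsReflectionAxis σ x d) (hd : 0 < d)
    (h1 : ¬ G.IsBridge s(x (d - 1), x d)) : G.degree (x d) = 2 := by
  have := h.reverse.degree_zero hd (by rwa [Nat.sub_zero, Sym2.eq_swap])
  simpa using this

end Degree

end IsReflectionAxis

/-- The two fixed vertices at distance `diam G` span an axis. -/
theorem IsLongitudinallySymmetric.exists_isReflectionAxis [Finite V]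
    (h : G.IsLongitudinallySymmetric)
    (hG : G.IsCactus) (hT : G.bcTree.IsPathGraph) (hd : 0 < G.diam) :
    ∃ (σ : G ≃g G) (x : ℕ → V), G.IsReflectionAxis σ x G.diam := by
  obtain ⟨σ, hσ, ⟨u, v, huv, hu, hv⟩, hB, hC⟩ := h
  obtain ⟨x, h0, h1, hx⟩ := hG.1.exists_isGeodesic u v
  have hne : v ≠ u := by
    rintro rfl
    rw [dist_self] at huv
    omega
  rw [huv] at h1 hx
  refine ⟨σ, x, hG, hx, hσ, by rw [h0, hu], by rw [h1, hv], hB, hC, hT, ?_, ?_⟩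
  · rw [h0]; exact hG.1.not_isArticulationPoint_of_dist_eq_diam huv hne
  · rw [h1]
    exact hG.1.not_isArticulationPoint_of_dist_eq_diam (by rw [dist_comm, huv]) hne.symm

end SimpleGraph

namespace SimpleGraph

variable {V : Type*} [Fintype V] {G : SimpleGraph V} [DecidableRel G.Adj]

/-! ### The equality cases -/

namespace IsReflectionAxis

variable {σ : G ≃g G} {x : ℕ → V} {d : ℕ}

theorem exists_degree_eq (h : G.IsReflectionAxis σ x d) (hd : 0 < d) (v : V) :
    ∃ i ≤ d, G.degree v = G.degree (x i) ∧ (v = x i ∨ v = σ (x i)) := by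
  obtain ⟨i, hi, h'⟩ := h.exists_eq_or_eq hd v
  refine ⟨i, hi, ?_, h'⟩
  rcases h' with rfl | rfl
  exacts [rfl, degree_apply _]

theorem degree_le_two_or (h : G.IsReflectionAxis σ x d) (hd : 0 < d)
    (hb : ∀ i < d, G.IsBridge s(x i, x (i + 1)) → G.degree (x i) ≤ 2 ∨ G.degree (x (i + 1)) ≤ 2)
    {a b : V} (hab : G.Adj a b) : G.degree a ≤ 2 ∨ G.degree b ≤ 2 := by
  have key : ∀ i < d, G.degree (x i) ≤ 2 ∨ G.degree (x (i + 1)) ≤ 2 := by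
    intro i hi
    by_cases hbr : G.IsBridge s(x i, x (i + 1))
    · exact hb i hi hbr
    · rw [h.isBridge_iff hi, not_and_or] at hbr
      exact hbr.imp (fun h' => (h.degree_of_moved hi.le h').le)
        fun h' => (h.degree_of_moved hi h').le
  rw [← h.pathUnion_eq hd] at hab
  have key' : ∀ i < d, G.degree (σ (x i)) ≤ 2 ∨ G.degree (σ (x (i + 1))) ≤ 2 := by
    simpa only [degree_apply] using key
  obtain ⟨⟨i, hi, h' | h'⟩, -⟩ := pathUnion_adj.1 hab <;>
  rcases Sym2.eq_iff.1 h' with ⟨rfl, rfl⟩ | ⟨rfl, rfl⟩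
  exacts [key i hi, (key i hi).symm, key' i hi, (key' i hi).symm]

theorem sum_vertexWeight_of_forall_not_isBridge (h : G.IsReflectionAxis σ x d) (hd : 0 < d)
    (hnb : ∀ e ∈ G.edgeSet, ¬ G.IsBridge e) :
    ∑ v, G.vertexWeight v = ∑ v, (1 + (√2 - 1) / 2 * ((G.degree v : ℝ) - 2)) := by
  have hdeg : ∀ v, G.degree v = 2 ∨ G.degree v = 4 := by
    intro v
    obtain ⟨i, hi, hv, -⟩ := h.exists_degree_eq hd v
    rw [hv]
    rcases Nat.eq_zero_or_pos i with rfl | h0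
    · exact Or.inl (h.degree_zero hd (hnb _ (h.geodesic.adj 0 hd)))
    obtain ⟨i, rfl⟩ : ∃ j, i = j + 1 := ⟨i - 1, by omega⟩
    rcases hi.eq_or_lt with rfl | hi
    · exact Or.inl (h.degree_end hd (hnb _ (h.geodesic.adj i (by omega))))
    by_cases hf : σ (x (i + 1)) = x (i + 1)
    · exact Or.inr (h.degree_of_fixed hi hf (hnb _ (h.geodesic.adj i (by omega)))
        (hnb _ (h.geodesic.adj (i + 1) hi)))
    · exact Or.inl (h.degree_of_moved hi.le hf)
  refine Finset.sum_congr rfl fun v _ => ?_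
  have h2 := sqrt_two_div_two_mul_self
  have h4 : √(4 : ℝ) = 2 := by
    rw [show (4 : ℝ) = 2 ^ 2 by norm_num, Real.sqrt_sq (by norm_num)]
  rcases hdeg v with hv | hv <;> rw [vertexWeight_of_two_le (by omega), hv] <;> push_cast
  · linarith
  · rw [h4]; ring

/-- With two leaves, and no bridges but the two pendant edges, the neighbours of the leaves have
degree `3` and all other vertices have degree `2` or `4`. -/
theorem degrees_of_two_leaves (h : G.IsReflectionAxis σ x d) (hd : 0 < d)
    (hk : 0 < G.cycles.ncard) (hb : G.bridges.ncard = 2)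
    (hl : {v | G.degree v = 1}.ncard = 2) :
    2 < d ∧ G.degree (x 0) = 1 ∧ G.degree (x d) = 1 ∧ G.degree (x 1) = 3 ∧
      G.degree (x (d - 1)) = 3 ∧ (∀ i < d, G.IsBridge s(x i, x (i + 1)) → i = 0 ∨ i + 1 = d) ∧
      ∀ i, 1 < i → i + 1 < d → G.degree (x i) = 2 ∨ G.degree (x i) = 4 := by
  classical
  obtain ⟨C, hC⟩ := (Set.ncard_pos (Set.toFinite _)).1 hk
  have hsub : {v | G.degree v = 1} ⊆ ({x 0, x d} : Set V) := by
    intro v hv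
    obtain ⟨i, hi, hv', hvi⟩ := h.exists_degree_eq hd v
    have h1 : G.degree (x i) = 1 := hv'.symm.trans hv
    have : i = 0 ∨ i = d := by
      by_contra! hn
      obtain ⟨i, rfl⟩ := Nat.exists_eq_succ_of_ne_zero hn.1
      have := h.geodesic.two_le_degree (t := i) (by omega)
      rw [Nat.succ_eq_add_one] at h1
      omega
    rcases this with rfl | rfl
    · rw [h.fix_zero, or_self] at hvi; exact Or.inl hvi
    · rw [h.fix_end, or_self] at hvi; exact Or.inr hvi
  have hleaves : {v | G.degree v = 1} = ({x 0, x d} : Set V) :=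
    Set.eq_of_subset_of_ncard_le hsub (by rw [hl]; exact (Set.ncard_insert_le _ _).trans (by rw [Set.ncard_singleton]))
  have h0 : G.degree (x 0) = 1 := hleaves.ge (Or.inl rfl)
  have hd1 : G.degree (x d) = 1 := hleaves.ge (Or.inr rfl)
  have hne1 : d ≠ 1 := by
    rintro rfl
    exact h.cactus.1.not_adjacent_leaves hC (h.geodesic.adj 0 hd) ⟨h0, hd1⟩
  have hb0 : G.IsBridge s(x 0, x 1) := by
    by_contra hn
    have := h.degree_zero hd hn
    omega
  have hbd : G.IsBridge s(x (d - 1), x d) := by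
    by_contra hn
    have := h.degree_end hd hn
    omega
  have hde : d - 1 + 1 = d := by omega
  have hpair : ({s(x 0, x 1), s(x (d - 1), x d)} : Set (Sym2 V)) ⊆ G.bridges := by
    rintro e (rfl | rfl)
    · exact ⟨h.geodesic.adj 0 hd, hb0⟩
    · refine ⟨?_, hbd⟩
      have := h.geodesic.adj (d - 1) (by omega)
      rwa [hde] at this
  have hnep : s(x 0, x 1) ≠ s(x (d - 1), x d) := by
    intro h'
    have := h.geodesic.edge_injOn (i := 0) (j := d - 1) hd (by omega) (by rw [hde]; exact h')
    omega
  have hbridges : ({s(x 0, x 1), s(x (d - 1), x d)} : Set (Sym2 V)) = G.bridges :=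
    Set.eq_of_subset_of_ncard_le hpair (by rw [hb, Set.ncard_pair hnep])
  have honly : ∀ i < d, G.IsBridge s(x i, x (i + 1)) → i = 0 ∨ i + 1 = d := by
    intro i hi hbr
    have : s(x i, x (i + 1)) ∈ G.bridges := ⟨h.geodesic.adj i hi, hbr⟩
    rw [← hbridges] at this
    rcases this with h' | h'
    · exact Or.inl (h.geodesic.edge_injOn hi hd h')
    · have := h.geodesic.edge_injOn (j := d - 1) hi (by omega) (by rw [hde]; exact h')
      omega
  have hd2 : 2 < d := by
    by_contra hle
    have hall : ∀ i < d, G.IsBridge s(x i, x (i + 1)) := by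
      intro i hi
      obtain rfl : d = 2 := by omega
      rcases (show i = 0 ∨ i = 1 by omega) with rfl | rfl
      exacts [hb0, hbd]
    obtain ⟨a, ha⟩ := (connected_of_mem_cycles hC).nonempty
    obtain ⟨b, hab⟩ := exists_adj_of_mem_cycles hC ha
    have hG := hab.adj_sub
    rw [← h.pathUnion_eq hd] at hG
    obtain ⟨⟨i, hi, h' | h'⟩, -⟩ := pathUnion_adj.1 hG
    · exact not_isBridge_of_mem_cycles hC (e := s(a, b)) hab (h' ▸ hall i hi)
    · obtain ⟨h1, h2⟩ := (h.isBridge_iff hi).1 (hall i hi)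
      rw [h1, h2] at h'
      exact not_isBridge_of_mem_cycles hC (e := s(a, b)) hab (h' ▸ hall i hi)
  refine ⟨hd2, h0, hd1, ?_, ?_, honly, ?_⟩
  · exact h.degree_of_isBridge (i := 0) (by omega) hb0 fun h' => by
      have := honly 1 (by omega) h'; omega
  · have h1 : G.IsBridge s(x (d - 0), x (d - 1)) := by rw [Nat.sub_zero, Sym2.eq_swap]; exact hbd
    refine h.reverse.degree_of_isBridge (i := 0) (by omega) h1 fun h' => ?_
    have := honly (d - 2) (by omega) (by
      rw [show d - 2 + 1 = d - (0 + 1) by omega, Sym2.eq_swap]; exact h')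
    omega
  · intro i h1 h2
    obtain ⟨i, rfl⟩ : ∃ j, i = j + 1 := ⟨i - 1, by omega⟩
    by_cases hf : σ (x (i + 1)) = x (i + 1)
    · refine Or.inr (h.degree_of_fixed (by omega) hf (fun h' => ?_) fun h' => ?_)
      · have := honly i (by omega) h'; omega
      · have := honly (i + 1) (by omega) h'; omega
    · exact Or.inl (h.degree_of_moved (by omega) hf)

theorem sum_vertexWeight_of_two_leaves (h : G.IsReflectionAxis σ x d) (hd : 0 < d)
    (hk : 0 < G.cycles.ncard) (hb : G.bridges.ncard = 2)
    (hl : {v | G.degree v = 1}.ncard = 2) :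
    ∑ v, G.vertexWeight v = ∑ v, (1 + (√2 - 1) / 2 * ((G.degree v : ℝ) - 2)) +
      (-3 + 2 / √3 + 2 * √(2 / 3)) := by
  classical
  obtain ⟨hd2, h0, hd1, h1, h1', -, hmid⟩ := h.degrees_of_two_leaves hd hk hb hl
  have hde : d - 1 + 1 = d := by omega
  have hcase : ∀ v, (v = x 0 ∨ v = x d) ∨ (v = x 1 ∨ v = x (d - 1)) ∨
      (G.degree v = 2 ∨ G.degree v = 4) := by
    intro v
    have hf1 : σ (x 1) = x 1 := by
      by_contra hf
      have := h.degree_of_moved (by omega) hf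
      omega
    have hf2 : σ (x (d - 1)) = x (d - 1) := by
      by_contra hf
      have := h.degree_of_moved (by omega) hf
      omega
    obtain ⟨i, hi, hv, hvi⟩ := h.exists_degree_eq hd v
    rcases (show i = 0 ∨ i = d ∨ i = 1 ∨ i = d - 1 ∨ (1 < i ∧ i + 1 < d) by omega) with
      rfl | rfl | rfl | rfl | ⟨h2, h3⟩
    · rw [h.fix_zero, or_self] at hvi; exact Or.inl (Or.inl hvi)
    · rw [h.fix_end, or_self] at hvi; exact Or.inl (Or.inr hvi)
    · rw [hf1, or_self] at hvi; exact Or.inr (Or.inl (Or.inl hvi))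
    · rw [hf2, or_self] at hvi; exact Or.inr (Or.inl (Or.inr hvi))
    · rw [hv]; exact Or.inr (Or.inr (hmid i h2 h3))
  have hne : ∀ {i j}, i ≤ d → j ≤ d → i ≠ j → x i ≠ x j := fun hi hj hij h' =>
    hij (h.geodesic.injOn hi hj h')
  -- the corrections at the leaves and at their neighbours
  set κ₁ : ℝ := 1 / 2 + (1 - √2 / 2) / √(3 : ℕ) - (1 + (√2 - 1) / 2 * ((1 : ℕ) - 2)) with hκ₁
  set κ₃ : ℝ := √2 / 2 * √(3 : ℕ) - (1 + (√2 - 1) / 2 * ((3 : ℕ) - 2)) with hκ₃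
  have hw : ∀ v, G.vertexWeight v = 1 + (√2 - 1) / 2 * ((G.degree v : ℝ) - 2) +
      ((if v ∈ ({x 0, x d} : Finset V) then κ₁ else 0) +
        if v ∈ ({x 1, x (d - 1)} : Finset V) then κ₃ else 0) := by
    intro v
    have hleaf : ∀ {v w}, G.degree v = 1 → G.Adj v w → G.degree w = 3 →
        G.vertexWeight v = 1 + (√2 - 1) / 2 * ((G.degree v : ℝ) - 2) + κ₁ := by
      intro v w hv hvw hw
      rw [vertexWeight_of_degree_eq_one hv hvw, hv, hw, hκ₁]
      ring
    have hthree : ∀ {v}, G.degree v = 3 →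
        G.vertexWeight v = 1 + (√2 - 1) / 2 * ((G.degree v : ℝ) - 2) + κ₃ := by
      intro v hv
      rw [vertexWeight_of_two_le (by omega), hv, hκ₃]
      ring
    rcases hcase v with hv | hv | hv
    · have h2 : v ∉ ({x 1, x (d - 1)} : Finset V) := by
        rw [Finset.mem_insert, Finset.mem_singleton]
        rintro (rfl | rfl) <;> rcases hv with hv | hv <;>
          exact hne (by omega) (by omega) (by omega) hv
      rw [if_pos (by simpa using hv), if_neg h2, add_zero]
      rcases hv with rfl | rfl
      · exact hleaf h0 (h.geodesic.adj 0 hd) h1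
      · have := h.geodesic.adj (d - 1) (by omega)
        rw [hde] at this
        exact hleaf hd1 this.symm h1'
    · have h2 : v ∉ ({x 0, x d} : Finset V) := by
        rw [Finset.mem_insert, Finset.mem_singleton]
        rintro (rfl | rfl) <;> rcases hv with hv | hv <;>
          exact hne (by omega) (by omega) (by omega) hv
      rw [if_neg h2, if_pos (by simpa using hv), zero_add]
      rcases hv with rfl | rfl
      exacts [hthree h1, hthree h1']
    · rw [if_neg, if_neg]
      · have h2 := sqrt_two_div_two_mul_self
        have h4 : √(4 : ℝ) = 2 := by
          rw [show (4 : ℝ) = 2 ^ 2 by norm_num, Real.sqrt_sq (by norm_num)]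
        rcases hv with hv | hv <;> rw [vertexWeight_of_two_le (by omega), hv] <;> push_cast
        · linarith
        · rw [h4]; ring
      · rw [Finset.mem_insert, Finset.mem_singleton]
        rintro (rfl | rfl) <;> omega
      · rw [Finset.mem_insert, Finset.mem_singleton]
        rintro (rfl | rfl) <;> omega
  rw [Finset.sum_congr rfl fun v _ => hw v, Finset.sum_add_distrib, Finset.sum_add_distrib,
    Finset.sum_add_distrib, Finset.sum_ite_mem, Finset.sum_ite_mem, Finset.univ_inter, Finset.univ_inter,
    Finset.sum_const, Finset.sum_const, Finset.sum_const,
    Finset.card_pair (hne (by omega) le_rfl (by omega)),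
    Finset.card_pair (hne (by omega) (by omega) (by omega)), bridge_const_eq, hκ₁, hκ₃]
  simp only [nsmul_eq_mul]
  push_cast
  ring

/-- From the sum of the vertex weights to the values of `R - d` and `R - d / 2`. -/
theorem randicIndex_eq [DecidableEq V] (h : G.IsReflectionAxis σ x d) (hd : 0 < d)
    (hk : 0 < G.cycles.ncard)
    (hb : ∀ i < d, G.IsBridge s(x i, x (i + 1)) → G.degree (x i) ≤ 2 ∨ G.degree (x (i + 1)) ≤ 2)
    {c : ℝ}
    (hc : ∑ v, G.vertexWeight v = ∑ v, (1 + (√2 - 1) / 2 * ((G.degree v : ℝ) - 2)) + c) :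
    G.randicIndex - d = -(G.bridges.ncard : ℝ) / 2 - ((G.cycles.ncard : ℝ) - 1) * (2 - √2) + c ∧
    G.randicIndex - (d : ℝ) / 2 = ((Fintype.card V : ℝ) - G.bridges.ncard) / 4 -
      ((G.cycles.ncard : ℝ) - 1) * (7 / 4 - √2) + c := by
  obtain ⟨C, hC⟩ := (Set.ncard_pos (Set.toFinite _)).1 hk
  have hR := randicIndex_eq_sum_vertexWeight
    (fun x y hxy => h.cactus.1.not_adjacent_leaves hC hxy)
    (fun x y hxy => h.degree_le_two_or hd hb hxy)
  have hm := (Nat.cast_inj (R := ℝ)).2 h.cactus.card_edgeFinset_add_one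
  have hd' := (Nat.cast_inj (R := ℝ)).2 (h.card_edgeFinset_add hd)
  have hs : ∑ v, (G.degree v : ℝ) = 2 * (G.edgeFinset.card : ℝ) := by
    exact_mod_cast G.sum_degrees_eq_twice_card_edges
  push_cast at hm hd'
  have hsum : ∑ v, (1 + (√2 - 1) / 2 * ((G.degree v : ℝ) - 2)) =
      Fintype.card V + (√2 - 1) * ((G.edgeFinset.card : ℝ) - Fintype.card V) := by
    rw [Finset.sum_add_distrib, ← Finset.mul_sum, Finset.sum_sub_distrib, hs]
    simp only [Finset.sum_const, Finset.card_univ, nsmul_eq_mul]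
    ring
  have hmn : (G.edgeFinset.card : ℝ) - Fintype.card V = (G.cycles.ncard : ℝ) - 1 := by linarith
  rw [hc, hsum, hmn] at hR
  constructor <;> rw [hR] <;> linarith

end IsReflectionAxis

end SimpleGraph

theorem corollary1p5 {V : Type*} [Fintype V] [DecidableEq V] (G : SimpleGraph V)
    [DecidableRel G.Adj] (hG : G.IsCactus) (n k b : ℕ) (hn : n = Fintype.card V)
    (hk : k = G.cycles.ncard) (hb : b = G.bridges.ncard) (hk_pos : 0 < k) :
    (b = 0 →
      (G.randicIndex - G.diam ≥ -((k : ℝ) - 1) * (2 - √2) ∧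
        G.randicIndex - (G.diam : ℝ) / 2 ≥ (n : ℝ) / 4 - ((k : ℝ) - 1) * (7 / 4 - √2)) ∧
      (G.bcTree.IsPathGraph → G.IsLongitudinallySymmetric →
        G.randicIndex - G.diam = -((k : ℝ) - 1) * (2 - √2) ∧
        G.randicIndex - (G.diam : ℝ) / 2 =
          (n : ℝ) / 4 - ((k : ℝ) - 1) * (7 / 4 - √2))) ∧
    (0 < b →
      (G.randicIndex - G.diam ≥
          -(b : ℝ) / 2 - ((k : ℝ) - 1) * (2 - √2) - 3 + 2 / √3 + 2 * √(2 / 3) ∧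
        G.randicIndex - (G.diam : ℝ) / 2 ≥
          ((n : ℝ) - b) / 4 - ((k : ℝ) - 1) * (7 / 4 - √2) - 3 + 2 / √3 + 2 * √(2 / 3)) ∧
      (G.bcTree.IsPathGraph → G.IsLongitudinallySymmetric →
        b = 2 → {v | G.degree v = 1}.ncard = 2 →
        G.randicIndex - G.diam =
          -(b : ℝ) / 2 - ((k : ℝ) - 1) * (2 - √2) - 3 + 2 / √3 + 2 * √(2 / 3) ∧
        G.randicIndex - (G.diam : ℝ) / 2 =
          ((n : ℝ) - b) / 4 - ((k : ℝ) - 1) * (7 / 4 - √2) - 3 + 2 / √3 + 2 * √(2 / 3))) := by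
  subst hn hk hb
  obtain ⟨C, hC⟩ := (Set.ncard_pos (Set.toFinite _)).1 hk_pos
  obtain ⟨z, hz⟩ := (SimpleGraph.connected_of_mem_cycles hC).nonempty
  obtain ⟨w, hw⟩ := SimpleGraph.exists_adj_of_mem_cycles hC hz
  have : Nontrivial V := ⟨z, w, hw.ne⟩
  have hd : 0 < G.diam := Nat.pos_of_ne_zero (SimpleGraph.connected_iff_diam_ne_zero.1 hG.1)
  obtain ⟨u, v, huv⟩ := G.exists_dist_eq_diam
  obtain ⟨x, -, -, hx⟩ := hG.1.exists_isGeodesic u v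
  rw [huv] at hx
  have hdle := (Nat.cast_le (α := ℝ)).2 (hG.two_mul_length_le hx)
  have hm := (Nat.cast_inj (R := ℝ)).2 hG.card_edgeFinset_add_one
  push_cast at hdle hm
  constructor
  · intro hb
    have hnb : ∀ e ∈ G.edgeSet, ¬ G.IsBridge e := by
      intro e he hbr
      have : e ∈ G.bridges := ⟨he, hbr⟩
      rw [(Set.ncard_eq_zero (Set.toFinite _)).1 hb] at this
      exact this
    rw [hb, Nat.cast_zero] at hdle
    refine ⟨?_, fun hT hS => ?_⟩
    · have h2 := hG.randicIndex_sub_half_ge hx hd hk_pos (Or.inr ⟨rfl, hnb⟩)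
      rw [hb, Nat.cast_zero] at h2
      constructor <;> linarith
    · obtain ⟨σ, y, hy⟩ := hS.exists_isReflectionAxis hG hT hd
      obtain ⟨h1, h2⟩ := hy.randicIndex_eq hd hk_pos
        (fun i hi h' => absurd h' (hnb _ (hy.geodesic.adj i hi)))
        ((hy.sum_vertexWeight_of_forall_not_isBridge hd hnb).trans (add_zero _).symm)
      rw [hb, Nat.cast_zero] at h1 h2
      constructor <;> linarith
  · intro _
    refine ⟨?_, fun hT hS hb hl => ?_⟩
    · have h2 := hG.randicIndex_sub_half_ge hx hd hk_pos (Or.inl rfl)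
      constructor <;> linarith
    · obtain ⟨σ, y, hy⟩ := hS.exists_isReflectionAxis hG hT hd
      obtain ⟨-, h0, hd1, -, -, honly, -⟩ := hy.degrees_of_two_leaves hd hk_pos hb hl
      obtain ⟨h1, h2⟩ := hy.randicIndex_eq hd hk_pos (fun i hi h' => by
        rcases honly i hi h' with rfl | h3
        · exact Or.inl (by omega)
        · exact Or.inr (by rw [h3]; omega)) (hy.sum_vertexWeight_of_two_leaves hd hk_pos hb hl)
      constructor <;> linarith
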